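/- **Theorem 4.1 (Dimension Reduction).** Let $n\ge 2$, $p\in[2,\infty)$, and let $\omega_2\subset\mathbb R^{n-1}$ be a nonempty bounded open set. Write $x=(x_1,X_2)\in\mathbb R\times\mathbb R^{n-1}$ and $\Omega_\ell=(-\ell,\ell)\times\omega_2$ for $\ell>0$. Let $$A(X_2)=\begin{pmatrix}a_{11}(X_2)&A_{12}(X_2)\\A_{12}^t(X_2)&A_{22}(X_2)\end{pmatrix}$$ be a measurable field of real symmetric $n\times n$ matrices on $\omega_2$, with $a_{11}$ scalar and $A_{22}$ of size $(n-1)\times(n-1)$, for which there are constants $M,c>0$ with $|A(X_2)\xi|\le M|\xi|$ and $A(X_2)\xi\cdot\xi\ge c|\xi|^2$ for a.e. $X_2\in\omega_2$ and all $\xi\in\mathbb R^n$. Let $V(\Omega_\ell)$ be the space of functions of $W^{1,p}(\Omega_\ell)$ vanishing on the lateral boundary $(-\ell,\ell)\times\partial\omega_2$, that is, the closure in $W^{1,p}(\Omega_\ell)$ of the restrictions to $\Omega_\ell$ of functions in $C_c^\infty(\mathbb R\times\omega_2)$; let $W^{1,p}_0(\omega_2)$ be the closure of $C_c^\infty(\omega_2)$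 in $W^{1,p}(\omega_2)$. A number $\lambda\in\mathbb R$ is an eigenvalue of the mixed problem on $\Omega_\ell$ (Dirichlet on $(-\ell,\ell)\times\partial\omega_2$, Neumann $A\nabla u\cdot\nu=0$ on $\{-\ell,\ell\}\times\omega_2$) if there is $u\in V(\Omega_\ell)$, $u\ne0$, with $$\int_{\Omega_\ell}|A\nabla u\cdot\nabla u|^{\frac{p-2}{2}}A\nabla u\cdot\nabla v=\lambda\int_{\Omega_\ell}|u|^{p-2}uv\qquad\text{for all }v\in V(\Omega_\ell).$$ Then for every $\ell>0$ there is a smallest eigenvalue $\lambda^1_M(\Omega_\ell)$, and $$\lim_{\ell\to0^+}\lambda^1_M(\Omega_\ell)=\Lambda,$$ where $$\Lambda=\inf\left\{\int_{\omega_2}\left(A_{22}\nabla u\cdot\nabla u-\frac{|A_{12}\cdot\nabla u|^2}{a_{11}}\right)^{\frac p2}:\ u\in W^{1,p}_0(\omega_2),\ \int_{\omega_2}|u|^p=1\right\}.$$ -/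

import Mathlib

open MeasureTheory Set Filter Topology
open scoped Gradient

noncomputable section

namespace MixedEigen

/-- Euclidean space `ℝ^N`. -/
abbrev Eu (N : ℕ) : Type := EuclideanSpace ℝ (Fin N)

/-- `φ ∈ C_c^∞(U)`, as a function on `ℝ^N` with compact support contained in `U`. -/
def IsTestFunction {N : ℕ} (U : Set (Eu N)) (φ : Eu N → ℝ) : Prop :=
  ContDiff ℝ (⊤ : ℕ∞) φ ∧ HasCompactSupport φ ∧ tsupport φ ⊆ U

/-- `g` is the weak (distributional) gradient of `u` on `Ω`. Only used together with
local integrability of `u` and `g` on `Ω`. -/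
def HasWeakGradient {N : ℕ} (Ω : Set (Eu N)) (u : Eu N → ℝ) (g : Eu N → Eu N) : Prop :=
  ∀ φ : Eu N → ℝ, IsTestFunction Ω φ → ∀ i : Fin N,
    ∫ x in Ω, u x * (∇ φ x) i = - ∫ x in Ω, g x i * φ x

/-- `u ∈ W^{1,p}(Ω)` with weak gradient `g`. -/
def MemW1p {N : ℕ} (p : ℝ) (Ω : Set (Eu N)) (u : Eu N → ℝ) (g : Eu N → Eu N) : Prop :=
  MemLp u (ENNReal.ofReal p) (volume.restrict Ω) ∧
  MemLp g (ENNReal.ofReal p) (volume.restrict Ω) ∧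
  HasWeakGradient Ω u g

/-- `u` (with weak gradient `g`) belongs to the closure, in the norm of `W^{1,p}(Ω)`, of the
set of restrictions to `Ω` of the functions of `C_c^∞(U)`. -/
def MemW1pClosure {N : ℕ} (p : ℝ) (Ω U : Set (Eu N)) (u : Eu N → ℝ) (g : Eu N → Eu N) :
    Prop :=
  MemW1p p Ω u g ∧
  ∃ φ : ℕ → Eu N → ℝ, (∀ k, IsTestFunction U (φ k)) ∧
    Tendsto (fun k => eLpNorm (fun x => u x - φ k x) (ENNReal.ofReal p) (volume.restrict Ω))
      atTop (𝓝 0) ∧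
    Tendsto (fun k => eLpNorm (fun x => g x - ∇ (φ k) x) (ENNReal.ofReal p)
      (volume.restrict Ω)) atTop (𝓝 0)

/-- `u ∈ W_0^{1,p}(Ω)` with weak gradient `g`: the closure of `C_c^∞(Ω)` in `W^{1,p}(Ω)`. -/
def MemW1pZero {N : ℕ} (p : ℝ) (Ω : Set (Eu N)) (u : Eu N → ℝ) (g : Eu N → Eu N) : Prop :=
  MemW1pClosure p Ω Ω u g

/-- The component `X₂ = (x₂, …, x_n)` of `x = (x₁, X₂) ∈ ℝ^n`, where `n = d + 1`. -/
def X2 {d : ℕ} (x : Eu (d + 1)) : Eu d := WithLp.toLp 2 (fun j => x j.succ)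

/-- The infinite cylinder `ℝ × ω`. -/
def strip {d : ℕ} (ω : Set (Eu d)) : Set (Eu (d + 1)) := {x | X2 x ∈ ω}

/-- The cylinder `Ω_ℓ = (-ℓ, ℓ) × ω`. -/
def cylinder {d : ℕ} (ω : Set (Eu d)) (ℓ : ℝ) : Set (Eu (d + 1)) :=
  {x | x 0 ∈ Ioo (-ℓ) ℓ ∧ X2 x ∈ ω}

/-- `u ∈ V(Ω_ℓ)` with weak gradient `g`: the functions of `W^{1,p}(Ω_ℓ)` that vanish on the
lateral boundary `(-ℓ, ℓ) × ∂ω` (with no condition on the ends `{-ℓ, ℓ} × ω`). They are the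
limits in `W^{1,p}(Ω_ℓ)` of the functions smooth up to the ends which vanish near the lateral
boundary, that is, of the restrictions to `Ω_ℓ` of functions of `C_c^∞(ℝ × ω)`. -/
def MemV {d : ℕ} (p : ℝ) (ω : Set (Eu d)) (ℓ : ℝ)
    (u : Eu (d + 1) → ℝ) (g : Eu (d + 1) → Eu (d + 1)) : Prop :=
  MemW1pClosure p (cylinder ω ℓ) (strip ω) u g

/-- `B ξ · η`. -/
def form {N : ℕ} (B : Matrix (Fin N) (Fin N) ℝ) (ξ η : Eu N) : ℝ :=
  inner ℝ (Matrix.toEuclideanLin B ξ) η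

/-- `A` is measurable, symmetric, uniformly bounded and uniformly positive definite on `ω`. -/
structure IsAdmissible {N d : ℕ} (ω : Set (Eu d)) (A : Eu d → Matrix (Fin N) (Fin N) ℝ) :
    Prop where
  measurable : ∀ i j, AEMeasurable (fun y => A y i j) (volume.restrict ω)
  symm : ∀ᵐ y ∂(volume.restrict ω), (A y).IsSymm
  bounded : ∃ M : ℝ, ∀ᵐ y ∂(volume.restrict ω), ∀ ξ : Eu N,
    ‖Matrix.toEuclideanLin (A y) ξ‖ ≤ M * ‖ξ‖
  elliptic : ∃ c : ℝ, 0 < c ∧ ∀ᵐ y ∂(volume.restrict ω), ∀ ξ : Eu N,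
    c * ‖ξ‖ ^ 2 ≤ form (A y) ξ ξ

/-- `lam` is an eigenvalue of
`-div(|A∇u·∇u|^{(p-2)/2} A∇u) = lam |u|^{p-2} u` in `Ω_ℓ`, `u = 0` on `(-ℓ, ℓ) × ∂ω`,
`A∇u·ν = 0` on `{-ℓ, ℓ} × ω`, in the weak sense, where `A = A(X₂)`. -/
def IsMixedEigenvalue {d : ℕ} (p : ℝ) (ω : Set (Eu d))
    (A : Eu d → Matrix (Fin (d + 1)) (Fin (d + 1)) ℝ) (ℓ lam : ℝ) : Prop :=
  ∃ (u : Eu (d + 1) → ℝ) (g : Eu (d + 1) → Eu (d + 1)), MemV p ω ℓ u g ∧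
    ¬ (u =ᵐ[volume.restrict (cylinder ω ℓ)] 0) ∧
    ∀ (v : Eu (d + 1) → ℝ) (h : Eu (d + 1) → Eu (d + 1)), MemV p ω ℓ v h →
      ∫ x in cylinder ω ℓ,
          |form (A (X2 x)) (g x) (g x)| ^ ((p - 2) / 2) * form (A (X2 x)) (g x) (h x)
        = lam * ∫ x in cylinder ω ℓ, |u x| ^ (p - 2) * u x * v x

/-- The first (smallest) eigenvalue `λ¹_M(Ω_ℓ)` of the mixed problem. -/
def firstMixedEigenvalue {d : ℕ} (p : ℝ) (ω : Set (Eu d))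
    (A : Eu d → Matrix (Fin (d + 1)) (Fin (d + 1)) ℝ) (ℓ : ℝ) : ℝ :=
  sInf {lam : ℝ | IsMixedEigenvalue p ω A ℓ lam}

/-- The block `a₁₁`. -/
def a11 {d : ℕ} (B : Matrix (Fin (d + 1)) (Fin (d + 1)) ℝ) : ℝ := B 0 0

/-- The block `A₁₂`, a vector of `ℝ^{n-1}`. -/
def A12 {d : ℕ} (B : Matrix (Fin (d + 1)) (Fin (d + 1)) ℝ) : Eu d :=
  WithLp.toLp 2 (fun j => B 0 j.succ)

/-- The block `A₂₂`. -/
def A22 {d : ℕ} (B : Matrix (Fin (d + 1)) (Fin (d + 1)) ℝ) : Matrix (Fin d) (Fin d) ℝ :=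
  B.submatrix Fin.succ Fin.succ

/-- The number `Λ`: the infimum of
`∫_ω (A₂₂∇u·∇u - |A₁₂·∇u|²/a₁₁)^{p/2}` over `u ∈ W_0^{1,p}(ω)` with `∫_ω |u|^p = 1`. -/
def limitValue {d : ℕ} (p : ℝ) (ω : Set (Eu d))
    (A : Eu d → Matrix (Fin (d + 1)) (Fin (d + 1)) ℝ) : ℝ :=
  sInf {E : ℝ | ∃ (u : Eu d → ℝ) (g : Eu d → Eu d), MemW1pZero p ω u g ∧
    ∫ y in ω, |u y| ^ p = 1 ∧
    E = ∫ y in ω, (form (A22 (A y)) (g y) (g y)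
      - |(inner ℝ (A12 (A y)) (g y) : ℝ)| ^ 2 / a11 (A y)) ^ (p / 2)}

end MixedEigen

end

/-! Completing the square in the first component gives `Aξ·ξ = a₁₁(ξ₁ + A₁₂·ξ'/a₁₁)² + (A₂₂ξ'·ξ' -
|A₁₂·ξ'|²/a₁₁)` for `ξ = (ξ₁, ξ')`. The integrand defining `Λ` is therefore the minimum of
`(Aξ·ξ)^{p/2}` over `ξ₁`, attained at `ξ₁ = -A₁₂·ξ'/a₁₁` (`form_lift`, `form_lift_le`).

Lower bound: on each slice `x₁ = s`, a test function is a competitor for `Λ`, and replacing its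
`x₁`-derivative by the optimal value only lowers the energy. Integration in `s` and density give
first eigenvalue `≥ Λ` for every `ℓ` (`limitValue_mul_le_of_mem_sobolevClosure`).

Upper bound: the ends carry no boundary condition, so `φ(X₂) + x₁ψ(X₂)` is admissible. Its gradient
is `(ψ, ∇φ + x₁∇ψ)`. With `φ` close to a near-minimizer `u` of `Λ` and `ψ` close in `L^p` to
`-A₁₂·∇u/a₁₁`, this is nearly the optimal vector once `|x₁| < ℓ` is small, so the Rayleigh quotient
falls below any `T > Λ` (`exists_forall_le_of_limitValue_lt`).

Existence of a smallest eigenvalue (`exists_isLeast_isMixedEigenvalue`) comes from minimizing the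
Rayleigh quotient. Clarkson's inequality, available since `p ≥ 2`, makes minimizing sequences
strongly Cauchy once their images in `L^p` converge (`exists_minimizer_of_clarkson`), so no weak
topology is used. The compact embedding is obtained by approximating it with averages over small
convex cells, the error being controlled by a Poincaré inequality. A minimizer solves the equation
(`eulerLagrange_of_minimizer`), and any eigenvalue is the Rayleigh quotient of its eigenfunction,
hence at least the minimum.

Sobolev functions are handled as pairs `(u, ∇u)` in a closed subspace of `L^p × L^p`, so
inequalities need only be checked for test functions. -/

noncomputable section

namespace MixedEigen

/-! ### Pointwise inequalities for elliptic quadratic forms. -/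

section Form

variable {N : ℕ}

theorem form_eq_sum (B : Matrix (Fin N) (Fin N) ℝ) (ξ η : Eu N) :
    form B ξ η = ∑ i, ∑ j, B i j * ξ j * η i := by
  simp only [form, PiLp.inner_apply, Matrix.toLpLin_apply, Matrix.mulVec, dotProduct,
    RCLike.inner_apply, conj_trivial, Finset.mul_sum]
  exact Finset.sum_congr rfl fun i _ => Finset.sum_congr rfl fun j _ => by ring

theorem form_add_left (B : Matrix (Fin N) (Fin N) ℝ) (ξ ξ' η : Eu N) :
    form B (ξ + ξ') η = form B ξ η + form B ξ' η := by
  simp [form, inner_add_left]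

theorem form_add_right (B : Matrix (Fin N) (Fin N) ℝ) (ξ η η' : Eu N) :
    form B ξ (η + η') = form B ξ η + form B ξ η' := by
  simp [form, inner_add_right]

theorem form_smul_left (B : Matrix (Fin N) (Fin N) ℝ) (t : ℝ) (ξ η : Eu N) :
    form B (t • ξ) η = t * form B ξ η := by
  simp [form, inner_smul_left]

theorem form_smul_right (B : Matrix (Fin N) (Fin N) ℝ) (t : ℝ) (ξ η : Eu N) :
    form B ξ (t • η) = t * form B ξ η := by
  simp [form, inner_smul_right]

theorem form_comm {B : Matrix (Fin N) (Fin N) ℝ} (hB : B.IsSymm) (ξ η : Eu N) :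
    form B ξ η = form B η ξ := by
  rw [form_eq_sum, form_eq_sum, Finset.sum_comm]
  refine Finset.sum_congr rfl fun i _ => Finset.sum_congr rfl fun j _ => ?_
  rw [hB.apply i j]; ring

/-- A symmetric matrix with `‖B ξ‖ ≤ M ‖ξ‖` and `c ‖ξ‖² ≤ B ξ · ξ`. -/
structure IsEllipticMatrix (M c : ℝ) (B : Matrix (Fin N) (Fin N) ℝ) : Prop where
  symm : B.IsSymm
  bounded : ∀ ξ : Eu N, ‖Matrix.toEuclideanLin B ξ‖ ≤ M * ‖ξ‖
  elliptic : ∀ ξ : Eu N, c * ‖ξ‖ ^ 2 ≤ form B ξ ξ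

namespace IsEllipticMatrix

variable {M c : ℝ} {B : Matrix (Fin N) (Fin N) ℝ}

theorem abs_form_le (h : IsEllipticMatrix M c B) (ξ η : Eu N) :
    |form B ξ η| ≤ M * ‖ξ‖ * ‖η‖ :=
  (abs_real_inner_le_norm _ _).trans
    (mul_le_mul_of_nonneg_right (h.bounded ξ) (norm_nonneg _))

theorem form_self_nonneg (h : IsEllipticMatrix M c B) (hc : 0 ≤ c) (ξ : Eu N) :
    0 ≤ form B ξ ξ := (by positivity : 0 ≤ c * ‖ξ‖ ^ 2).trans (h.elliptic ξ)

theorem form_self_le (h : IsEllipticMatrix M c B) (ξ : Eu N) :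
    form B ξ ξ ≤ M * ‖ξ‖ ^ 2 := by
  have := (le_abs_self _).trans (h.abs_form_le ξ ξ)
  nlinarith

theorem form_add_smul_self (h : IsEllipticMatrix M c B) (t : ℝ) (ξ η : Eu N) :
    form B (ξ + t • η) (ξ + t • η) =
      form B ξ ξ + 2 * t * form B ξ η + t ^ 2 * form B η η := by
  rw [form_add_left, form_add_right, form_add_right, form_smul_left, form_smul_left,
    form_smul_right, form_smul_right, form_comm h.symm η ξ]
  ring

theorem form_sq_le (h : IsEllipticMatrix M c B) (hc : 0 ≤ c) (ξ η : Eu N) :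
    form B ξ η ^ 2 ≤ form B ξ ξ * form B η η := by
  have := discrim_le_zero (a := form B η η) (b := 2 * form B ξ η) (c := form B ξ ξ) fun t => by
    have := h.form_self_nonneg hc (ξ + t • η)
    rw [h.form_add_smul_self] at this
    nlinarith
  unfold discrim at this
  nlinarith

theorem sqrt_form_add_le (h : IsEllipticMatrix M c B) (hc : 0 ≤ c) (ξ η : Eu N) :
    √(form B (ξ + η) (ξ + η)) ≤ √(form B ξ ξ) + √(form B η η) := by
  have h1 := h.form_self_nonneg hc ξ
  have h2 := h.form_self_nonneg hc η
  refine Real.sqrt_le_iff.2 ⟨by positivity, ?_⟩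
  have h3 := h.form_add_smul_self 1 ξ η
  have h4 : form B ξ η ≤ √(form B ξ ξ) * √(form B η η) := by
    rw [← Real.sqrt_mul h1]
    exact Real.le_sqrt_of_sq_le (h.form_sq_le hc ξ η)
  simp only [one_smul] at h3
  nlinarith [Real.sq_sqrt h1, Real.sq_sqrt h2]

/-- This is the reverse triangle inequality for the seminorm `ξ ↦ √(form B ξ ξ)`, itself at most `√M
‖ξ‖`. It is the source of continuity of the energy on `L^p`. -/
theorem abs_sqrt_form_sub_le (h : IsEllipticMatrix M c B) (hc : 0 ≤ c) (ξ η : Eu N) :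
    |√(form B ξ ξ) - √(form B η η)| ≤ √M * ‖ξ - η‖ := by
  have key (a b : Eu N) : √(form B a a) - √(form B b b) ≤ √M * ‖a - b‖ := by
    have h1 := h.sqrt_form_add_le hc b (a - b)
    rw [add_sub_cancel] at h1
    have h2 : √(form B (a - b) (a - b)) ≤ √M * ‖a - b‖ := by
      refine (Real.sqrt_le_sqrt (h.form_self_le (a - b))).trans ?_
      rw [Real.sqrt_mul' _ (by positivity), Real.sqrt_sq (norm_nonneg _)]
    linarith
  refine abs_sub_le_iff.2 ⟨key ξ η, ?_⟩
  rw [norm_sub_rev]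
  exact key η ξ

/-- Clarkson's inequality for the exponent `2 s ≥ 2`. -/
theorem clarkson (h : IsEllipticMatrix M c B) (hc : 0 ≤ c) {s : ℝ} (hs : 1 ≤ s) (ξ η : Eu N) :
    form B ((2 : ℝ)⁻¹ • (ξ - η)) ((2 : ℝ)⁻¹ • (ξ - η)) ^ s
      + form B ((2 : ℝ)⁻¹ • (ξ + η)) ((2 : ℝ)⁻¹ • (ξ + η)) ^ s
      ≤ (form B ξ ξ ^ s + form B η η ^ s) / 2 := by
  have h1 := h.form_self_nonneg hc ξ
  have h2 := h.form_self_nonneg hc η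
  have e1 := h.form_add_smul_self 1 ξ η
  have e2 := h.form_add_smul_self (-1) ξ η
  simp only [one_smul, neg_smul, ← sub_eq_add_neg] at e1 e2
  -- The parallelogram identity reduces the claim to numbers: superadditivity of `x ^ s` bounds the
  -- left side by the power of this sum, and convexity of `x ^ s` bounds that power.
  have hsum : form B ((2 : ℝ)⁻¹ • (ξ - η)) ((2 : ℝ)⁻¹ • (ξ - η))
      + form B ((2 : ℝ)⁻¹ • (ξ + η)) ((2 : ℝ)⁻¹ • (ξ + η))
      = 1 / 2 * form B ξ ξ + 1 / 2 * form B η η := by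
    simp only [form_smul_left, form_smul_right, e1, e2]; ring
  refine (Real.add_rpow_le_rpow_add (h.form_self_nonneg hc _) (h.form_self_nonneg hc _) hs).trans ?_
  rw [hsum]
  exact ((convexOn_rpow hs).2 h1 h2 (by norm_num : (0 : ℝ) ≤ 1 / 2) (by norm_num) (by norm_num)).trans
    (le_of_eq (by simp only [smul_eq_mul]; ring))

end IsEllipticMatrix

end Form

/-! ### The energy functional on `L^p`: continuity, Clarkson's inequality, coercivity,
differentiability. -/

section Energy

variable {α : Type*} [MeasurableSpace α] {μ : Measure α} {N : ℕ}

/-- A measurable field of uniformly bounded and uniformly elliptic symmetric matrices. -/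
structure IsEllipticField (μ : Measure α) (M c : ℝ) (B : α → Matrix (Fin N) (Fin N) ℝ) :
    Prop where
  pos : 0 < c
  nonneg : 0 ≤ M
  measurable : ∀ i j, AEMeasurable (fun x => B x i j) μ
  ae_elliptic : ∀ᵐ x ∂μ, IsEllipticMatrix M c (B x)

theorem aestronglyMeasurable_coord {g : α → Eu N} (hg : AEStronglyMeasurable g μ) (i : Fin N) :
    AEStronglyMeasurable (fun x => g x i) μ :=
  (EuclideanSpace.proj (𝕜 := ℝ) i).continuous.comp_aestronglyMeasurable hg

theorem aestronglyMeasurable_form {B : α → Matrix (Fin N) (Fin N) ℝ}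
    (hB : ∀ i j, AEMeasurable (fun x => B x i j) μ) {g h : α → Eu N}
    (hg : AEStronglyMeasurable g μ) (hh : AEStronglyMeasurable h μ) :
    AEStronglyMeasurable (fun x => form (B x) (g x) (h x)) μ := by
  simp only [form_eq_sum]
  refine Finset.aestronglyMeasurable_fun_sum _ fun i _ =>
    Finset.aestronglyMeasurable_fun_sum _ fun j _ => ?_
  exact ((hB i j).aestronglyMeasurable.mul (aestronglyMeasurable_coord hg j)).mul
    (aestronglyMeasurable_coord hh i)

theorem sqrt_rpow_eq_rpow_half {a p : ℝ} (ha : 0 ≤ a) : √a ^ p = a ^ (p / 2) := by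
  rw [Real.sqrt_eq_rpow, ← Real.rpow_mul ha]; congr 1; ring

/-- The energy `∫ (B g · g)^{p/2}`. -/
def energy (μ : Measure α) (B : α → Matrix (Fin N) (Fin N) ℝ) (p : ℝ) (g : α → Eu N) : ℝ :=
  ∫ x, form (B x) (g x) (g x) ^ (p / 2) ∂μ

theorem energy_congr {B : α → Matrix (Fin N) (Fin N) ℝ} {p : ℝ} {g h : α → Eu N}
    (hgh : g =ᵐ[μ] h) : energy μ B p g = energy μ B p h :=
  integral_congr_ae (by filter_upwards [hgh] with x hx; rw [hx])

theorem integral_abs_rpow_eq_norm {E : Type*} [NormedAddCommGroup E] {p : ℝ} (hp : 0 < p)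
    (u : Lp E (ENNReal.ofReal p) μ) : ∫ x, ‖u x‖ ^ p ∂μ = ‖u‖ ^ p := by
  have h := (Lp.memLp u).eLpNorm_eq_integral_rpow_norm (by simpa using hp) (by simp)
  rw [ENNReal.toReal_ofReal hp.le] at h
  have h0 : 0 ≤ ∫ x, ‖u x‖ ^ p ∂μ := integral_nonneg fun x => by positivity
  rw [Lp.norm_def, h, ENNReal.toReal_ofReal (by positivity), ← Real.rpow_mul h0,
    inv_mul_cancel₀ hp.ne', Real.rpow_one]

namespace IsEllipticField

variable {M c p : ℝ} {B : α → Matrix (Fin N) (Fin N) ℝ}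

theorem memLp_sqrt_form (hB : IsEllipticField μ M c B) {q : ENNReal} {g : α → Eu N}
    (hg : MemLp g q μ) : MemLp (fun x => √(form (B x) (g x) (g x))) q μ := by
  refine hg.of_le_mul (c := √M) ?_ ?_
  · exact Real.continuous_sqrt.comp_aestronglyMeasurable
      (aestronglyMeasurable_form hB.measurable hg.1 hg.1)
  · filter_upwards [hB.ae_elliptic] with x hx
    have := hx.abs_sqrt_form_sub_le hB.pos.le (g x) 0
    simpa [form] using this

/-- The map `g ↦ (B g · g)^{1/2}` on `L^p`. -/
def sqrtForm (hB : IsEllipticField μ M c B) (q : ENNReal) (g : Lp (Eu N) q μ) : Lp ℝ q μ :=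
  (hB.memLp_sqrt_form (Lp.memLp g)).toLp _

theorem lipschitzWith_sqrtForm (hB : IsEllipticField μ M c B) (q : ENNReal) [Fact (1 ≤ q)] :
    LipschitzWith (Real.toNNReal (√M)) (hB.sqrtForm q) := by
  refine LipschitzWith.of_dist_le_mul fun g h => ?_
  rw [dist_eq_norm, dist_eq_norm, Real.coe_toNNReal _ (Real.sqrt_nonneg _)]
  refine Lp.norm_le_mul_norm_of_ae_le_mul ?_
  filter_upwards [hB.ae_elliptic, Lp.coeFn_sub g h, Lp.coeFn_sub (hB.sqrtForm q g)
    (hB.sqrtForm q h), (hB.memLp_sqrt_form (Lp.memLp g)).coeFn_toLp,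
    (hB.memLp_sqrt_form (Lp.memLp h)).coeFn_toLp] with x hx h1 h2 h3 h4
  rw [h1, h2]
  simp only [Pi.sub_apply, sqrtForm, h3, h4]
  exact hx.abs_sqrt_form_sub_le hB.pos.le _ _

theorem energy_eq_norm_sqrtForm (hB : IsEllipticField μ M c B) (hp : 0 < p)
    (g : Lp (Eu N) (ENNReal.ofReal p) μ) :
    energy μ B p g = ‖hB.sqrtForm (ENNReal.ofReal p) g‖ ^ p := by
  rw [← integral_abs_rpow_eq_norm hp]
  refine integral_congr_ae ?_
  filter_upwards [hB.ae_elliptic, (hB.memLp_sqrt_form (Lp.memLp g)).coeFn_toLp] with x hx h1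
  simp only [sqrtForm, h1, Real.norm_eq_abs, abs_of_nonneg (Real.sqrt_nonneg _)]
  rw [sqrt_rpow_eq_rpow_half (hx.form_self_nonneg hB.pos.le _)]

/-- The energy is the `p`-th power of the `L^p` norm of `sqrtForm g`, and `sqrtForm` is Lipschitz.
-/
theorem continuous_energy (hB : IsEllipticField μ M c B) (hp : 1 ≤ p)
    [Fact (1 ≤ ENNReal.ofReal p)] :
    Continuous fun g : Lp (Eu N) (ENNReal.ofReal p) μ => energy μ B p g := by
  simp only [hB.energy_eq_norm_sqrtForm (zero_lt_one.trans_le hp)]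
  exact (hB.lipschitzWith_sqrtForm _).continuous.norm.rpow_const fun _ => Or.inr (by linarith)

theorem integrable_energy (hB : IsEllipticField μ M c B) (hp : 0 < p) {g : α → Eu N}
    (hg : MemLp g (ENNReal.ofReal p) μ) :
    Integrable (fun x => form (B x) (g x) (g x) ^ (p / 2)) μ := by
  have h := (hB.memLp_sqrt_form hg).integrable_norm_rpow (by simpa using hp) (by simp)
  rw [ENNReal.toReal_ofReal hp.le] at h
  refine h.congr ?_
  filter_upwards [hB.ae_elliptic] with x hx
  rw [Real.norm_eq_abs, abs_of_nonneg (Real.sqrt_nonneg _),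
    sqrt_rpow_eq_rpow_half (hx.form_self_nonneg hB.pos.le _)]

theorem energy_nonneg (hB : IsEllipticField μ M c B) (g : α → Eu N) : 0 ≤ energy μ B p g := by
  refine integral_nonneg_of_ae ?_
  filter_upwards [hB.ae_elliptic] with x hx
  exact Real.rpow_nonneg (hx.form_self_nonneg hB.pos.le _) _

theorem energy_smul (hB : IsEllipticField μ M c B) (t : ℝ) (g : α → Eu N) :
    energy μ B p (fun x => t • g x) = |t| ^ p * energy μ B p g := by
  unfold energy
  rw [← integral_const_mul]
  refine integral_congr_ae ?_
  filter_upwards [hB.ae_elliptic] with x hx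
  have h0 := hx.form_self_nonneg hB.pos.le (g x)
  simp only [form_smul_left, form_smul_right, ← mul_assoc]
  rw [Real.mul_rpow (mul_self_nonneg t) h0, ← sqrt_rpow_eq_rpow_half (mul_self_nonneg t), Real.sqrt_mul_self_eq_abs]

theorem energy_clarkson (hB : IsEllipticField μ M c B) (hp : 2 ≤ p) {g h : α → Eu N}
    (hg : MemLp g (ENNReal.ofReal p) μ) (hh : MemLp h (ENNReal.ofReal p) μ) :
    energy μ B p (fun x => (2 : ℝ)⁻¹ • (g x - h x)) + energy μ B p (fun x => (2 : ℝ)⁻¹ • (g x + h x))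
      ≤ (energy μ B p g + energy μ B p h) / 2 := by
  have hp0 : 0 < p := by linarith
  have i1 := hB.integrable_energy hp0 ((hg.sub hh).const_smul (2 : ℝ)⁻¹)
  have i2 := hB.integrable_energy hp0 ((hg.add hh).const_smul (2 : ℝ)⁻¹)
  have i3 := hB.integrable_energy hp0 hg
  have i4 := hB.integrable_energy hp0 hh
  simp only [Pi.smul_apply, Pi.sub_apply, Pi.add_apply] at i1 i2
  unfold energy
  rw [← integral_add i1 i2, ← integral_add i3 i4, ← integral_div]
  refine integral_mono_ae (i1.add i2) ((i3.add i4).div_const _) ?_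
  filter_upwards [hB.ae_elliptic] with x hx
  exact hx.clarkson hB.pos.le (by linarith) (g x) (h x)

theorem norm_rpow_le_energy (hB : IsEllipticField μ M c B) (hp : 0 < p)
    (g : Lp (Eu N) (ENNReal.ofReal p) μ) :
    c ^ (p / 2) * ‖g‖ ^ p ≤ energy μ B p g := by
  rw [← integral_abs_rpow_eq_norm hp, ← integral_const_mul]
  have h := (Lp.memLp g).integrable_norm_rpow (by simpa using hp) (by simp)
  rw [ENNReal.toReal_ofReal hp.le] at h
  refine integral_mono_ae (h.const_mul _) (hB.integrable_energy hp (Lp.memLp g)) ?_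
  filter_upwards [hB.ae_elliptic] with x hx
  have := hx.elliptic (g x)
  have hn : ‖g x‖ ^ p = (‖g x‖ ^ 2) ^ (p / 2) := by
    rw [← sqrt_rpow_eq_rpow_half (by positivity), Real.sqrt_sq (norm_nonneg _)]
  have hc := hB.pos
  simp only [hn]
  rw [← Real.mul_rpow hc.le (by positivity)]
  exact Real.rpow_le_rpow (by positivity) this (by positivity)

end IsEllipticField

/-- Differentiation under the integral sign for the `p/2`-th power of a quadratic polynomial in the
parameter. -/
theorem hasDerivAt_integral_quadratic_rpow {p : ℝ} (hp : 2 ≤ p) {a b q G : α → ℝ}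
    (ha : AEStronglyMeasurable a μ) (hb : AEStronglyMeasurable b μ)
    (hq : AEStronglyMeasurable q μ) (hG : MemLp G (ENNReal.ofReal p) μ)
    (haG : ∀ᵐ x ∂μ, |a x| ≤ G x ^ 2) (hbG : ∀ᵐ x ∂μ, |b x| ≤ G x ^ 2)
    (hqG : ∀ᵐ x ∂μ, |q x| ≤ G x ^ 2)
    (hpos : ∀ᵐ x ∂μ, ∀ t : ℝ, 0 ≤ a x + 2 * t * b x + t ^ 2 * q x) :
    HasDerivAt (fun t : ℝ => ∫ x, (a x + 2 * t * b x + t ^ 2 * q x) ^ (p / 2) ∂μ)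
      (p * ∫ x, a x ^ ((p - 2) / 2) * b x ∂μ) 0 := by
  have hp0 : 0 < p := by linarith
  have hGi : Integrable (fun x => (4 * G x ^ 2) ^ (p / 2)) μ := by
    have h := ((hG.const_mul 2).integrable_norm_rpow (by simpa using hp0) (by simp))
    rw [ENNReal.toReal_ofReal hp0.le] at h
    refine h.congr (Eventually.of_forall fun x => ?_)
    simp only
    rw [← sqrt_rpow_eq_rpow_half (by positivity), Real.norm_eq_abs, ← Real.sqrt_sq_eq_abs]
    congr 2; ring
  have hm (t : ℝ) : AEStronglyMeasurable (fun x => a x + 2 * t * b x + t ^ 2 * q x) μ :=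
    (ha.add (hb.const_mul _)).add (hq.const_mul _)
  have hcont (s : ℝ) (hs : 0 ≤ s) : Continuous fun y : ℝ => y ^ s :=
    Real.continuous_rpow_const hs
  have key := hasDerivAt_integral_of_dominated_loc_of_deriv_le (μ := μ) (𝕜 := ℝ)
    (F := fun t x => (a x + 2 * t * b x + t ^ 2 * q x) ^ (p / 2))
    (F' := fun t x => (2 * b x + 2 * t * q x) * (p / 2)
      * (a x + 2 * t * b x + t ^ 2 * q x) ^ (p / 2 - 1))
    -- For `|t| < 1` both the quadratic polynomial and its `t`-derivative are at most `4 G²` in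
    -- absolute value, because `1 + 2 + 1 = 4` and `2 + 2 = 4`.
    (bound := fun x => p / 2 * (4 * G x ^ 2) ^ (p / 2))
    (x₀ := 0) (s := Metric.ball 0 1) (Metric.ball_mem_nhds _ one_pos)
    (Eventually.of_forall fun t => (hcont _ (by linarith)).comp_aestronglyMeasurable (hm t))
    ?_ ?_ ?_ (hGi.const_mul _) ?_
  · refine key.2.congr_deriv ?_
    rw [← integral_const_mul]
    congr 1; ext x
    simp only [mul_zero, zero_mul, add_zero, ne_eq, OfNat.ofNat_ne_zero, not_false_eq_true, zero_pow]
    rw [show (p - 2) / 2 = p / 2 - 1 by ring]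
    ring
  · refine hGi.mono' ((hcont _ (by linarith)).comp_aestronglyMeasurable (hm 0)) ?_
    filter_upwards [haG, hpos] with x h1 h2
    have := h2 0
    rw [Real.norm_eq_abs, abs_of_nonneg (Real.rpow_nonneg this _)]
    refine Real.rpow_le_rpow this ?_ (by linarith)
    have := le_abs_self (a x)
    nlinarith
  · refine AEStronglyMeasurable.mul ?_
      ((hcont _ (by linarith)).comp_aestronglyMeasurable (hm 0))
    exact ((hb.const_mul _).add (hq.const_mul _)).mul_const _
  · filter_upwards [haG, hbG, hqG, hpos] with x h1 h2 h3 h4 t ht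
    rw [Metric.mem_ball, dist_zero_right, Real.norm_eq_abs] at ht
    have hG0 : 0 ≤ G x ^ 2 := sq_nonneg _
    have ht2 : t ^ 2 ≤ 1 := by rw [← sq_abs]; nlinarith [abs_nonneg t]
    have hb1 : |t * b x| ≤ G x ^ 2 := by
      rw [abs_mul]; nlinarith [abs_nonneg t, abs_nonneg (b x)]
    have hq1 : |t * q x| ≤ G x ^ 2 := by
      rw [abs_mul]; nlinarith [abs_nonneg t, abs_nonneg (q x)]
    have hq2 : |t ^ 2 * q x| ≤ G x ^ 2 := by
      rw [abs_mul, abs_of_nonneg (sq_nonneg t)]; nlinarith [abs_nonneg (q x)]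
    have hle : a x + 2 * t * b x + t ^ 2 * q x ≤ 4 * G x ^ 2 := by
      linarith [le_abs_self (a x), le_abs_self (t * b x), le_abs_self (t ^ 2 * q x)]
    have hle2 : |2 * b x + 2 * t * q x| ≤ 4 * G x ^ 2 := by
      rw [abs_le]
      constructor <;>
      linarith [le_abs_self (b x), le_abs_self (t * q x), neg_abs_le (b x), neg_abs_le (t * q x)]
    have hr := Real.rpow_le_rpow (h4 t) hle (by linarith : 0 ≤ p / 2 - 1)
    rw [Real.norm_eq_abs, abs_mul, abs_mul, abs_of_nonneg (Real.rpow_nonneg (h4 t) _),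
      abs_of_pos (by linarith : 0 < p / 2)]
    -- Where `G` vanishes both sides are zero, even for `p = 2`, when the last factor is `0 ^ 0 =
    -- 1`.
    have he : (4 * G x ^ 2) ^ (p / 2) = 4 * G x ^ 2 * (4 * G x ^ 2) ^ (p / 2 - 1) := by
      rcases (by positivity : 0 ≤ 4 * G x ^ 2).eq_or_lt with h0 | h0
      · rw [← h0, Real.zero_rpow (by linarith), zero_mul]
      · rw [Real.rpow_sub_one h0.ne', mul_div_cancel₀ _ h0.ne']
    rw [he]
    calc |2 * b x + 2 * t * q x| * (p / 2) * (a x + 2 * t * b x + t ^ 2 * q x) ^ (p / 2 - 1)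
        ≤ (4 * G x ^ 2) * (p / 2) * (4 * G x ^ 2) ^ (p / 2 - 1) := by
          gcongr
          exact Real.rpow_nonneg (h4 t) _
      _ = _ := by ring
  · filter_upwards with x t _
    refine HasDerivAt.rpow_const ?_ (Or.inr (by linarith))
    have h1 : HasDerivAt (fun t : ℝ => 2 * t * b x) (2 * b x) t := by
      simpa using ((hasDerivAt_id t).const_mul 2).mul_const (b x)
    have h2 : HasDerivAt (fun t : ℝ => t ^ 2 * q x) (2 * t * q x) t := by
      simpa using (hasDerivAt_pow 2 t).mul_const (q x)
    exact ((h1.const_add (a x)).add h2).congr_deriv (by ring)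

end Energy

/-- A homogeneous, coercive functional which satisfies Clarkson's inequality attains its minimum on
the unit sphere of a compactly weaker norm. -/
theorem exists_minimizer_of_clarkson {X Y : Type*} [NormedAddCommGroup X] [NormedSpace ℝ X]
    [CompleteSpace X] [NormedAddCommGroup Y] [NormedSpace ℝ Y] (ι : X →L[ℝ] Y)
    (hι : IsCompactOperator ι) {J : X → ℝ} (hJ : Continuous J) {p C : ℝ} (hp : 0 < p) (hC : 0 < C)
    (hJ0 : ∀ x, 0 ≤ J x) (hom : ∀ (t : ℝ) (x : X), J (t • x) = |t| ^ p * J x)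
    (hJc : ∀ x y, J ((2 : ℝ)⁻¹ • (x - y)) + J ((2 : ℝ)⁻¹ • (x + y)) ≤ (J x + J y) / 2)
    (hcoer : ∀ x, C * ‖x‖ ^ p ≤ J x + ‖ι x‖ ^ p) (hne : ∃ x, ι x ≠ 0) :
    ∃ x, ‖ι x‖ = 1 ∧ ∀ y, J x * ‖ι y‖ ^ p ≤ J y := by
  set S : Set ℝ := J '' {x | ‖ι x‖ = 1} with hS
  have hbdd : BddBelow S := ⟨0, by rintro _ ⟨x, -, rfl⟩; exact hJ0 x⟩
  have norm_one {x : X} (hx : ι x ≠ 0) : ‖ι (‖ι x‖⁻¹ • x)‖ = 1 := by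
    rw [map_smul, norm_smul, norm_inv, norm_norm, inv_mul_cancel₀ (norm_ne_zero_iff.2 hx)]
  have hSne : S.Nonempty := by
    obtain ⟨x, hx⟩ := hne
    exact ⟨_, _, norm_one hx, rfl⟩
  -- Homogeneity extends the lower bound from the unit sphere to every vector.
  have hlow (w : X) : sInf S * ‖ι w‖ ^ p ≤ J w := by
    by_cases hw : ι w = 0
    · simpa [hw, Real.zero_rpow hp.ne'] using hJ0 w
    · have h1 := csInf_le hbdd ⟨_, norm_one hw, rfl⟩
      have h0 : 0 < ‖ι w‖ := norm_pos_iff.2 hw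
      rw [hom, abs_of_pos (inv_pos.2 h0), Real.inv_rpow h0.le, inv_mul_eq_div,
        le_div_iff₀ (Real.rpow_pos_of_pos h0 p)] at h1
      exact h1
  obtain ⟨s, -, hs, hsS⟩ := exists_seq_tendsto_sInf hSne hbdd
  choose x hx1 hxs using hsS
  have hx1 : ∀ k, ‖ι (x k)‖ = 1 := hx1
  have hJx : Tendsto (fun k => J (x k)) atTop (𝓝 (sInf S)) := by simpa only [hxs] using hs
  obtain ⟨R, hR⟩ : ∃ R, ∀ k, ‖x k‖ ≤ R := by
    obtain ⟨b, hb⟩ := hJx.bddAbove_range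
    refine ⟨((b + 1) / C) ^ p⁻¹, fun k => ?_⟩
    have h1 := hcoer (x k)
    have h2 : J (x k) ≤ b := hb ⟨k, rfl⟩
    rw [hx1, Real.one_rpow] at h1
    rw [Real.le_rpow_inv_iff_of_pos (norm_nonneg _)
      (div_nonneg (by linarith [hJ0 (x k)]) hC.le) hp, le_div_iff₀ hC]
    linarith
  obtain ⟨y, -, φ, hφ, hy⟩ := (hι.isCompact_closure_image_closedBall R).tendsto_subseq
    (x := fun k => ι (x k)) fun k => subset_closure ⟨x k, by simpa using hR k, rfl⟩
  set z : ℕ → X := fun k => x (φ k) with hz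
  have hιz : Tendsto (fun k => ι (z k)) atTop (𝓝 y) := hy
  have hJz : Tendsto (fun k => J (z k)) atTop (𝓝 (sInf S)) := hJx.comp hφ.tendsto_atTop
  have hy1 : ‖y‖ = 1 := tendsto_nhds_unique hιz.norm (by simp [hz, hx1])
  -- The midpoint of two late terms has `ι`-norm near 1, because their images are close, so its
  -- energy is almost at least `sInf S`. Clarkson's inequality then forces the energy of the
  -- half-difference to zero, and coercivity turns this into smallness of its norm in `X`.
  have hcauchy : CauchySeq z := by
    rw [cauchySeq_iff_tendsto_dist_atTop_0, ← prod_atTop_atTop_eq]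
    have f1 : Tendsto (fun n : ℕ × ℕ => n.1) (atTop ×ˢ atTop) atTop := tendsto_fst
    have f2 : Tendsto (fun n : ℕ × ℕ => n.2) (atTop ×ˢ atTop) atTop := tendsto_snd
    have g1 : Tendsto (fun n : ℕ × ℕ => ‖(2 : ℝ)⁻¹ • (ι (z n.1) + ι (z n.2))‖ ^ p)
        (atTop ×ˢ atTop) (𝓝 1) := by
      have h := (((hιz.comp f1).add (hιz.comp f2)).const_smul (2 : ℝ)⁻¹).norm.rpow_const
        (p := p) (Or.inr hp.le)
      have e : ‖(2 : ℝ)⁻¹ • (y + y)‖ = 1 := by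
        rw [← two_smul ℝ y, smul_smul]; simpa using hy1
      rwa [e, Real.one_rpow] at h
    have g2 : Tendsto (fun n : ℕ × ℕ => ‖(2 : ℝ)⁻¹ • (ι (z n.1) - ι (z n.2))‖ ^ p)
        (atTop ×ˢ atTop) (𝓝 0) := by
      have h := (((hιz.comp f1).sub (hιz.comp f2)).const_smul (2 : ℝ)⁻¹).norm.rpow_const
        (p := p) (Or.inr hp.le)
      simpa [Real.zero_rpow hp.ne'] using h
    have g3 : Tendsto (fun n : ℕ × ℕ => ((J (z n.1) + J (z n.2)) / 2
        - sInf S * ‖(2 : ℝ)⁻¹ • (ι (z n.1) + ι (z n.2))‖ ^ p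
        + ‖(2 : ℝ)⁻¹ • (ι (z n.1) - ι (z n.2))‖ ^ p)) (atTop ×ˢ atTop) (𝓝 0) := by
      have h := ((((hJz.comp f1).add (hJz.comp f2)).div_const 2).sub (g1.const_mul (sInf S))).add g2
      rwa [show (sInf S + sInf S) / 2 - sInf S * 1 + 0 = 0 by ring] at h
    have g4 : Tendsto (fun n : ℕ × ℕ => C * ‖(2 : ℝ)⁻¹ • (z n.1 - z n.2)‖ ^ p)
        (atTop ×ˢ atTop) (𝓝 0) := by
      refine squeeze_zero (fun n => by positivity) (fun n => ?_) g3
      have h1 := hcoer ((2 : ℝ)⁻¹ • (z n.1 - z n.2))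
      have h2 := hJc (z n.1) (z n.2)
      have h3 := hlow ((2 : ℝ)⁻¹ • (z n.1 + z n.2))
      simp only [map_smul, map_sub, map_add] at h1 h3
      linarith
    have g5 := ((g4.const_mul C⁻¹).rpow_const (p := p⁻¹) (Or.inr (by positivity))).const_mul 2
    rw [mul_zero, Real.zero_rpow (by positivity), mul_zero] at g5
    refine g5.congr fun n => ?_
    rw [← mul_assoc, inv_mul_cancel₀ hC.ne', one_mul, Real.rpow_rpow_inv (norm_nonneg _) hp.ne',
      norm_smul, dist_eq_norm, norm_inv, Real.norm_two, ← mul_assoc, mul_inv_cancel₀ two_ne_zero,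
      one_mul]
  obtain ⟨w, hw⟩ := cauchySeq_tendsto_of_complete hcauchy
  have e1 : ι w = y := tendsto_nhds_unique ((ι.continuous.tendsto w).comp hw) hιz
  have e2 : J w = sInf S := tendsto_nhds_unique ((hJ.tendsto w).comp hw) hJz
  exact ⟨w, by rw [e1, hy1], fun v => by rw [e2]; exact hlow v⟩

/-! ### The Poincaré inequality on bounded convex sets. -/

section Poincare

theorem lintegral_rpow_le_of_isProbabilityMeasure {α : Type*} [MeasurableSpace α] {μ : Measure α}
    [IsProbabilityMeasure μ] {p : ℝ} (hp : 1 < p) {f : α → ENNReal} (hf : AEMeasurable f μ) :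
    (∫⁻ x, f x ∂μ) ^ p ≤ ∫⁻ x, f x ^ p ∂μ := by
  have hp0 : 0 < p := by linarith
  have h := ENNReal.lintegral_mul_le_Lp_mul_Lq μ (Real.HolderConjugate.conjExponent hp) hf
    (aemeasurable_const (b := (1 : ENNReal)))
  simp only [Pi.mul_apply, mul_one, ENNReal.one_rpow, lintegral_const, measure_univ] at h
  calc (∫⁻ x, f x ∂μ) ^ p ≤ ((∫⁻ x, f x ^ p ∂μ) ^ (1 / p)) ^ p := by gcongr
    _ = _ := by rw [← ENNReal.rpow_mul, one_div, inv_mul_cancel₀ hp0.ne', ENNReal.rpow_one]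

variable {N : ℕ}

theorem lintegral_comp_add_smul_le {f : Eu N → ENNReal} (hf : Measurable f) (a : Eu N) {r : ℝ}
    (hr : 1 / 2 ≤ r) : ∫⁻ y, f (a + r • y) ≤ 2 ^ N * ∫⁻ y, f y := by
  have hr0 : 0 < r := by linarith
  have h1 : ∫⁻ y, f (a + r • y) = ∫⁻ y, f (a + y) ∂(Measure.map (r • ·) (volume : Measure (Eu N))) :=
    (lintegral_map (hf.comp (measurable_const_add a)) (measurable_const_smul r)).symm
  rw [h1, Measure.map_addHaar_smul volume hr0.ne', lintegral_smul_measure,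
    lintegral_add_left_eq_self f a, smul_eq_mul, finrank_euclideanSpace_fin]
  gcongr
  rw [abs_of_pos (by positivity)]
  calc ENNReal.ofReal (r ^ N)⁻¹ ≤ ENNReal.ofReal (2 ^ N) := by
        refine ENNReal.ofReal_le_ofReal ?_
        rw [← inv_pow]
        exact pow_le_pow_left₀ (by positivity) (inv_le_of_inv_le₀ (by norm_num) (by linarith)) _
    _ = 2 ^ N := by rw [ENNReal.ofReal_pow (by norm_num)]; norm_num

/-- The point is `(1 - t)x + ty`, and one coefficient is at least `1/2`. Integrating first in the
corresponding variable costs a Jacobian of at most `2 ^ N`; convexity keeps the point in `C`. -/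
theorem lintegral_lintegral_segment_le {C : Set (Eu N)} (hC : Convex ℝ C) (hCm : MeasurableSet C)
    {G : Eu N → ENNReal} (hG : Measurable G) {t : ℝ} (ht : t ∈ Icc (0 : ℝ) 1) :
    ∫⁻ x in C, ∫⁻ y in C, G (x + t • (y - x)) ≤ 2 ^ N * volume C * ∫⁻ x in C, G x := by
  have key {s r : ℝ} (hs : 0 ≤ s) (hr : 1 / 2 ≤ r) (hsr : s + r = 1) {x : Eu N} (hx : x ∈ C) :
      ∫⁻ y in C, G (s • x + r • y) ≤ 2 ^ N * ∫⁻ y in C, G y := by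
    rw [← lintegral_indicator hCm, ← lintegral_indicator hCm]
    refine le_trans (lintegral_mono fun y => ?_)
      (lintegral_comp_add_smul_le (hG.indicator hCm) (s • x) hr)
    by_cases hy : y ∈ C
    · rw [indicator_of_mem hy, indicator_of_mem (hC hx hy hs (by linarith) hsr)]
    · simp [hy]
  have main {s r : ℝ} (hs : 0 ≤ s) (hr : 1 / 2 ≤ r) (hsr : s + r = 1) :
      ∫⁻ x in C, ∫⁻ y in C, G (s • x + r • y) ≤ 2 ^ N * volume C * ∫⁻ x in C, G x := by
    calc ∫⁻ x in C, ∫⁻ y in C, G (s • x + r • y)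
        ≤ ∫⁻ _ in C, 2 ^ N * ∫⁻ y in C, G y :=
          setLIntegral_mono' hCm fun x hx => key hs hr hsr hx
      _ = _ := by rw [setLIntegral_const]; ring
  rcases le_total t (1 / 2) with h | h
  · rw [lintegral_lintegral_swap]
    · refine le_trans (le_of_eq ?_) (main ht.1 (by linarith : 1 / 2 ≤ 1 - t) (by ring))
      refine lintegral_congr fun y => lintegral_congr fun x => ?_
      congr 1; module
    · exact (hG.comp (by fun_prop : Measurable fun z : Eu N × Eu N => z.1 + t • (z.2 - z.1))).aemeasurable
  · refine le_trans (le_of_eq ?_) (main (by linarith [ht.2] : 0 ≤ 1 - t) h (by ring))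
    refine lintegral_congr fun y => lintegral_congr fun x => ?_
    congr 1; module

theorem continuous_gradient {φ : Eu N → ℝ} (hφ : ContDiff ℝ 1 φ) : Continuous (∇ φ) :=
  (InnerProductSpace.toDual ℝ (Eu N)).symm.continuous.comp (hφ.continuous_fderiv one_ne_zero)

/-- The fundamental theorem of calculus along the segment from `x` to `y`, followed by Jensen's
inequality in `t`. -/
theorem enorm_sub_rpow_le {φ : Eu N → ℝ} (hφ : ContDiff ℝ 1 φ) {p δ : ℝ} (hp : 1 < p)
    {x y : Eu N} (hxy : ‖y - x‖ ≤ δ) :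
    ‖φ x - φ y‖ₑ ^ p ≤
      ENNReal.ofReal δ ^ p * ∫⁻ t in Ioc (0 : ℝ) 1, ‖∇ φ (x + t • (y - x))‖ₑ ^ p := by
  have hgc := continuous_gradient hφ
  have hline : Continuous fun t : ℝ => ∇ φ (x + t • (y - x)) := hgc.comp (by fun_prop)
  have hd (t : ℝ) : HasDerivAt (fun t : ℝ => φ (x + t • (y - x)))
      (inner ℝ (∇ φ (x + t • (y - x))) (y - x)) t := by
    have h1 := (hφ.differentiable one_ne_zero (x + t • (y - x))).hasFDerivAt
    have h2 : HasDerivAt (fun t : ℝ => x + t • (y - x)) (y - x) t := by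
      simpa using ((hasDerivAt_id t).smul_const (y - x)).const_add x
    rw [inner_gradient_left]
    exact h1.comp_hasDerivAt t h2
  have hint : φ y - φ x = ∫ t in (0 : ℝ)..1, inner ℝ (∇ φ (x + t • (y - x))) (y - x) := by
    rw [intervalIntegral.integral_eq_sub_of_hasDerivAt (fun t _ => hd t)
      ((hline.inner continuous_const).intervalIntegrable _ _)]
    simp
  have : IsProbabilityMeasure (volume.restrict (Ioc (0 : ℝ) 1)) := ⟨by simp⟩
  have hδ : 0 ≤ δ := (norm_nonneg _).trans hxy
  have h3 : ‖φ x - φ y‖ₑ ≤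
      ENNReal.ofReal δ * ∫⁻ t in Ioc (0 : ℝ) 1, ‖∇ φ (x + t • (y - x))‖ₑ := by
    rw [← enorm_neg, neg_sub, hint, intervalIntegral.integral_of_le zero_le_one,
      ← lintegral_const_mul' _ _ ENNReal.ofReal_ne_top]
    refine (enorm_integral_le_lintegral_enorm _).trans (lintegral_mono fun t => ?_)
    rw [← ofReal_norm, ← ofReal_norm, ← ENNReal.ofReal_mul hδ]
    refine ENNReal.ofReal_le_ofReal ((norm_inner_le_norm _ _).trans ?_)
    rw [mul_comm]
    exact mul_le_mul_of_nonneg_right hxy (norm_nonneg _)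
  calc ‖φ x - φ y‖ₑ ^ p
      ≤ (ENNReal.ofReal δ * ∫⁻ t in Ioc (0 : ℝ) 1, ‖∇ φ (x + t • (y - x))‖ₑ) ^ p := by gcongr
    _ = ENNReal.ofReal δ ^ p * (∫⁻ t in Ioc (0 : ℝ) 1, ‖∇ φ (x + t • (y - x))‖ₑ) ^ p :=
        ENNReal.mul_rpow_of_nonneg _ _ (by linarith)
    _ ≤ _ := by
        gcongr
        exact lintegral_rpow_le_of_isProbabilityMeasure hp hline.enorm.measurable.aemeasurable

theorem lintegral_lintegral_enorm_sub_rpow_le {C : Set (Eu N)} (hC : Convex ℝ C)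
    (hCm : MeasurableSet C) {p δ : ℝ} (hp : 1 < p)
    (hδ : ∀ x ∈ C, ∀ y ∈ C, ‖y - x‖ ≤ δ) {φ : Eu N → ℝ} (hφ : ContDiff ℝ 1 φ) :
    ∫⁻ x in C, ∫⁻ y in C, ‖φ x - φ y‖ₑ ^ p ≤
      ENNReal.ofReal δ ^ p * (2 ^ N * volume C * ∫⁻ x in C, ‖∇ φ x‖ₑ ^ p) := by
  set G : Eu N → ENNReal := fun z => ‖∇ φ z‖ₑ ^ p with hG
  have hGc : Continuous G := (ENNReal.continuous_rpow_const).comp (continuous_gradient hφ).enorm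
  have hGm : Measurable G := hGc.measurable
  have hG3 : Measurable fun z : (Eu N × Eu N) × ℝ => G (z.1.1 + z.2 • (z.1.2 - z.1.1)) :=
    hGm.comp (by fun_prop)
  set ν : Measure (Eu N × Eu N) := (volume.restrict C).prod (volume.restrict C) with hν
  calc ∫⁻ x in C, ∫⁻ y in C, ‖φ x - φ y‖ₑ ^ p
      ≤ ∫⁻ x in C, ∫⁻ y in C, ENNReal.ofReal δ ^ p *
          ∫⁻ t in Ioc (0 : ℝ) 1, G (x + t • (y - x)) :=
        setLIntegral_mono' hCm fun x hx => setLIntegral_mono' hCm fun y hy =>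
          enorm_sub_rpow_le hφ hp (hδ x hx y hy)
    _ = ∫⁻ z : Eu N × Eu N, ENNReal.ofReal δ ^ p * (∫⁻ t in Ioc (0 : ℝ) 1, G (z.1 + t • (z.2 - z.1))) ∂ν := by
        rw [hν, lintegral_prod]
        exact (hG3.lintegral_prod_right'.const_mul _).aemeasurable
    _ = ENNReal.ofReal δ ^ p * ∫⁻ z : Eu N × Eu N, (∫⁻ t in Ioc (0 : ℝ) 1, G (z.1 + t • (z.2 - z.1))) ∂ν :=
        lintegral_const_mul _ hG3.lintegral_prod_right'
    _ = ENNReal.ofReal δ ^ p * ∫⁻ t in Ioc (0 : ℝ) 1, (∫⁻ z : Eu N × Eu N, G (z.1 + t • (z.2 - z.1)) ∂ν) := by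
        rw [lintegral_lintegral_swap hG3.aemeasurable]
    _ ≤ ENNReal.ofReal δ ^ p * ∫⁻ _ in Ioc (0 : ℝ) 1, 2 ^ N * volume C * ∫⁻ x in C, G x := by
        gcongr ENNReal.ofReal δ ^ p * ?_
        refine setLIntegral_mono' measurableSet_Ioc fun t ht => ?_
        have hGt : Measurable fun z : Eu N × Eu N => G (z.1 + t • (z.2 - z.1)) :=
          hGm.comp (by fun_prop)
        rw [hν, lintegral_prod _ hGt.aemeasurable]
        exact lintegral_lintegral_segment_le hC hCm hGm (Ioc_subset_Icc_self ht)
    _ = _ := by simp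

/-- The Poincaré inequality on a bounded convex set. -/
theorem lintegral_enorm_sub_average_rpow_le {C : Set (Eu N)} (hC : Convex ℝ C)
    (hCm : MeasurableSet C) (hCb : Bornology.IsBounded C) {p δ : ℝ} (hp : 1 < p)
    (hδ : ∀ x ∈ C, ∀ y ∈ C, ‖y - x‖ ≤ δ) {φ : Eu N → ℝ} (hφ : ContDiff ℝ 1 φ) :
    ∫⁻ x in C, ‖φ x - ⨍ y in C, φ y‖ₑ ^ p ≤
      ENNReal.ofReal δ ^ p * 2 ^ N * ∫⁻ x in C, ‖∇ φ x‖ₑ ^ p := by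
  by_cases h0 : volume C = 0
  · simp [Measure.restrict_eq_zero.2 h0]
  have htop : volume C ≠ ⊤ := hCb.measure_lt_top.ne
  set ν : Measure (Eu N) := (volume C)⁻¹ • volume.restrict C with hν
  have : IsProbabilityMeasure ν :=
    ⟨by simp [hν, ENNReal.inv_mul_cancel h0 htop]⟩
  have hφi : Integrable φ ν := by
    refine Integrable.smul_measure ?_ (ENNReal.inv_ne_top.2 h0)
    exact (hφ.continuous.continuousOn.integrableOn_compact
      hCb.isCompact_closure).mono_set subset_closure
  have havg : ⨍ y in C, φ y = ∫ y, φ y ∂ν := by simp [average, hν]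
  -- Jensen's inequality for the normalized measure `ν` reduces the deviation from the mean to the
  -- double integral of differences.
  have hpt (x : Eu N) : ‖φ x - ⨍ y in C, φ y‖ₑ ^ p ≤ (volume C)⁻¹ * ∫⁻ y in C, ‖φ x - φ y‖ₑ ^ p := by
    have h1 : φ x - ⨍ y in C, φ y = ∫ y, (φ x - φ y) ∂ν := by
      rw [integral_sub (integrable_const _) hφi, havg]; simp
    have h2 : AEMeasurable (fun y => ‖φ x - φ y‖ₑ) ν :=
      (continuous_const.sub hφ.continuous).enorm.measurable.aemeasurable
    calc ‖φ x - ⨍ y in C, φ y‖ₑ ^ p ≤ (∫⁻ y, ‖φ x - φ y‖ₑ ∂ν) ^ p := by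
          rw [h1]; gcongr; exact enorm_integral_le_lintegral_enorm _
      _ ≤ ∫⁻ y, ‖φ x - φ y‖ₑ ^ p ∂ν := lintegral_rpow_le_of_isProbabilityMeasure hp h2
      _ = _ := by rw [hν, lintegral_smul_measure, smul_eq_mul]
  calc ∫⁻ x in C, ‖φ x - ⨍ y in C, φ y‖ₑ ^ p
      ≤ ∫⁻ x in C, (volume C)⁻¹ * ∫⁻ y in C, ‖φ x - φ y‖ₑ ^ p := lintegral_mono hpt
    _ = (volume C)⁻¹ * ∫⁻ x in C, ∫⁻ y in C, ‖φ x - φ y‖ₑ ^ p :=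
        lintegral_const_mul' _ _ (ENNReal.inv_ne_top.2 h0)
    _ ≤ (volume C)⁻¹ * (ENNReal.ofReal δ ^ p * (2 ^ N * volume C * ∫⁻ x in C, ‖∇ φ x‖ₑ ^ p)) := by
        gcongr
        exact lintegral_lintegral_enorm_sub_rpow_le hC hCm hp hδ hφ
    _ = ((volume C)⁻¹ * volume C) *
          (ENNReal.ofReal δ ^ p * 2 ^ N * ∫⁻ x in C, ‖∇ φ x‖ₑ ^ p) := by ring
    _ = _ := by rw [ENNReal.inv_mul_cancel h0 htop, one_mul]

end Poincare

/-! ### Test functions and their gradients. -/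

section TestFunctions

variable {N : ℕ} {U Ω : Set (Eu N)} {φ ψ : Eu N → ℝ}

theorem gradient_apply (φ : Eu N → ℝ) (x : Eu N) (i : Fin N) :
    ∇ φ x i = fderiv ℝ φ x (EuclideanSpace.single i 1) := by
  rw [← inner_gradient_left, EuclideanSpace.inner_single_right]; simp

namespace IsTestFunction

theorem contDiff_one (hφ : IsTestFunction U φ) : ContDiff ℝ 1 φ := hφ.1.of_le (by exact_mod_cast le_top)

theorem differentiable (hφ : IsTestFunction U φ) : Differentiable ℝ φ :=
  hφ.contDiff_one.differentiable one_ne_zero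

theorem continuous (hφ : IsTestFunction U φ) : Continuous φ := hφ.1.continuous

theorem continuous_gradient (hφ : IsTestFunction U φ) : Continuous (∇ φ) :=
  MixedEigen.continuous_gradient hφ.contDiff_one

theorem gradient_eq_zero (hφ : IsTestFunction U φ) {x : Eu N} (hx : x ∉ U) : ∇ φ x = 0 := by
  have h : fderiv ℝ φ x = 0 :=
    image_eq_zero_of_notMem_tsupport fun h => hx (hφ.2.2 (tsupport_fderiv_subset ℝ h))
  simp [gradient, h]

theorem eq_zero (hφ : IsTestFunction U φ) {x : Eu N} (hx : x ∉ U) : φ x = 0 :=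
  image_eq_zero_of_notMem_tsupport fun h => hx (hφ.2.2 h)

theorem hasCompactSupport_gradient (hφ : IsTestFunction U φ) : HasCompactSupport (∇ φ) :=
  (hφ.2.1.fderiv ℝ).comp_left (g := (InnerProductSpace.toDual ℝ (Eu N)).symm) (map_zero _)

theorem memLp (hφ : IsTestFunction U φ) (q : ENNReal) (Ω : Set (Eu N)) :
    MemLp φ q (volume.restrict Ω) :=
  hφ.continuous.memLp_of_hasCompactSupport hφ.2.1

theorem memLp_gradient (hφ : IsTestFunction U φ) (q : ENNReal) (Ω : Set (Eu N)) :
    MemLp (∇ φ) q (volume.restrict Ω) :=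
  hφ.continuous_gradient.memLp_of_hasCompactSupport hφ.hasCompactSupport_gradient

theorem zero (U : Set (Eu N)) : IsTestFunction U (0 : Eu N → ℝ) :=
  ⟨contDiff_const, HasCompactSupport.zero, by simp [tsupport]⟩

theorem add (hφ : IsTestFunction U φ) (hψ : IsTestFunction U ψ) :
    IsTestFunction U (φ + ψ) :=
  ⟨hφ.1.add hψ.1, hφ.2.1.add hψ.2.1, (tsupport_add φ ψ).trans (union_subset hφ.2.2 hψ.2.2)⟩

theorem smul (t : ℝ) (hφ : IsTestFunction U φ) : IsTestFunction U (t • φ) :=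
  ⟨contDiff_const.smul hφ.1, hφ.2.1.smul_left (f := fun _ => t),
    (closure_mono (Function.support_const_smul_subset t φ)).trans hφ.2.2⟩

theorem gradient_add (hφ : IsTestFunction U φ) (hψ : IsTestFunction U ψ) :
    ∇ (φ + ψ) = ∇ φ + ∇ ψ := by
  ext1 x
  simp [gradient, fderiv_add (hφ.differentiable x) (hψ.differentiable x)]

theorem gradient_smul (t : ℝ) (hφ : IsTestFunction U φ) : ∇ (t • φ) = t • ∇ φ := by
  ext1 x
  simp [gradient, fderiv_const_smul (hφ.differentiable x)]

theorem exists_pos (hU : IsOpen U) {x₀ : Eu N} (hx₀ : x₀ ∈ U) :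
    ∃ φ : Eu N → ℝ, IsTestFunction U φ ∧ φ x₀ = 1 := by
  obtain ⟨f, h1, h2, h3, -, h5⟩ := exists_contDiff_tsupport_subset (n := (⊤ : ℕ∞)) (hU.mem_nhds hx₀)
  exact ⟨f, ⟨h3, h2, h1⟩, h5⟩

theorem hasWeakGradient (hφ : IsTestFunction U φ) (Ω : Set (Eu N)) :
    HasWeakGradient Ω φ (∇ φ) := by
  intro ψ hψ i
  have hc1 : Continuous fun x => fderiv ℝ φ x (EuclideanSpace.single i 1) :=
    (hφ.contDiff_one.continuous_fderiv one_ne_zero).clm_apply continuous_const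
  have hc2 : Continuous fun x => fderiv ℝ ψ x (EuclideanSpace.single i 1) :=
    (hψ.contDiff_one.continuous_fderiv one_ne_zero).clm_apply continuous_const
  -- Only `ψ` has to be supported in `Ω`: both integrals extend to the whole space, where
  -- integration by parts needs no regularity of `Ω` and no vanishing of `φ` on its boundary.
  rw [setIntegral_eq_integral_of_forall_compl_eq_zero fun x hx => by
      rw [hψ.gradient_eq_zero hx]; simp,
    setIntegral_eq_integral_of_forall_compl_eq_zero fun x hx => by
      rw [hψ.eq_zero hx, mul_zero]]
  simp only [gradient_apply]
  refine integral_mul_fderiv_eq_neg_fderiv_mul_of_integrable ?_ ?_ ?_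
    (fun x _ => hφ.differentiable x) (fun x _ => hψ.differentiable x)
  · exact (hc1.mul hψ.continuous).integrable_of_hasCompactSupport hψ.2.1.mul_left
  · exact (hφ.continuous.mul hc2).integrable_of_hasCompactSupport hφ.2.1.mul_right
  · exact (hφ.continuous.mul hψ.continuous).integrable_of_hasCompactSupport hφ.2.1.mul_right

theorem memW1pClosure (hφ : IsTestFunction U φ) (p : ℝ) (Ω : Set (Eu N)) :
    MemW1pClosure p Ω U φ (∇ φ) :=
  ⟨⟨hφ.memLp _ _, hφ.memLp_gradient _ _, hφ.hasWeakGradient Ω⟩, fun _ => φ, fun _ => hφ,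
    by simp, by simp⟩

end IsTestFunction

end TestFunctions

/-- Integration against a bounded function is continuous on `L^q` of a finite measure. -/
theorem exists_clm_integral_mul {α : Type*} [MeasurableSpace α] {μ : Measure α} [IsFiniteMeasure μ]
    {q : ENNReal} [hq : Fact (1 ≤ q)] {ψ : α → ℝ} (hψ : AEStronglyMeasurable ψ μ) {K : ℝ}
    (hK : ∀ x, |ψ x| ≤ K) : ∃ T : Lp ℝ q μ →L[ℝ] ℝ, ∀ u, T u = ∫ x, u x * ψ x ∂μ := by
  have hint (u : Lp ℝ q μ) : Integrable (fun x => u x * ψ x) μ :=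
    ((Lp.memLp u).integrable hq.out).mul_bdd hψ (Eventually.of_forall hK)
  let T : Lp ℝ q μ →ₗ[ℝ] ℝ :=
    { toFun := fun u => ∫ x, u x * ψ x ∂μ
      map_add' := fun u v => by
        rw [← integral_add (hint u) (hint v)]
        refine integral_congr_ae ?_
        filter_upwards [Lp.coeFn_add u v] with x hx
        rw [hx, Pi.add_apply, add_mul]
      map_smul' := fun t u => by
        rw [RingHom.id_apply, smul_eq_mul, ← integral_const_mul]
        refine integral_congr_ae ?_
        filter_upwards [Lp.coeFn_smul t u] with x hx
        rw [hx, Pi.smul_apply, smul_eq_mul, mul_assoc] }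
  refine ⟨T.mkContinuousOfExistsBound
    ⟨K * (μ univ ^ (1 / (1 : ENNReal).toReal - 1 / q.toReal)).toReal, fun u => ?_⟩, fun u => rfl⟩
  change ‖∫ x, u x * ψ x ∂μ‖ ≤ _
  have hu := (Lp.memLp u).integrable hq.out
  have hK0 (x : α) : 0 ≤ K := (abs_nonneg _).trans (hK x)
  calc ‖∫ x, u x * ψ x ∂μ‖ ≤ ∫ x, K * ‖u x‖ ∂μ := by
        refine norm_integral_le_of_norm_le (hu.norm.const_mul K) (Eventually.of_forall fun x => ?_)
        rw [norm_mul, mul_comm]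
        exact mul_le_mul_of_nonneg_right (hK x) (norm_nonneg _)
    _ = K * (eLpNorm u 1 μ).toReal := by
        rw [integral_const_mul, integral_norm_eq_lintegral_enorm hu.1, eLpNorm_one_eq_lintegral_enorm]
    _ ≤ K * ((eLpNorm u q μ * μ univ ^ (1 / (1 : ENNReal).toReal - 1 / q.toReal)).toReal) := by
        -- The sign of `K` is known only if `α` has a point.
        rcases isEmpty_or_nonempty α with h | ⟨⟨x⟩⟩
        · simp [Measure.eq_zero_of_isEmpty μ]
        refine mul_le_mul_of_nonneg_left (ENNReal.toReal_mono ?_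
          (eLpNorm_le_eLpNorm_mul_rpow_measure_univ hq.out hu.1)) (hK0 x)
        refine ENNReal.mul_ne_top (Lp.eLpNorm_ne_top u) (ENNReal.rpow_ne_top_of_nonneg ?_ (by simp))
        rcases eq_or_ne q ⊤ with rfl | h
        · simp
        · have : 1 ≤ q.toReal := by
            simpa using (ENNReal.toReal_le_toReal ENNReal.one_ne_top h).2 hq.out
          rw [ENNReal.toReal_one, one_div_one, sub_nonneg]
          exact div_le_one_of_le₀ this (by positivity)
    _ = _ := by rw [ENNReal.toReal_mul, Lp.norm_def]; ring

/-! ### Sobolev closures as closed subspaces of `L^p × L^p`. -/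

section Closure

variable {N : ℕ} (p : ℝ) [Fact (1 ≤ ENNReal.ofReal p)] (Ω U : Set (Eu N))

/-- The pairs `(φ, ∇φ)`, `φ ∈ C_c^∞(U)`, in `L^p(Ω) × L^p(Ω)`. -/
def testSubmodule : Submodule ℝ
    (Lp ℝ (ENNReal.ofReal p) (volume.restrict Ω) × Lp (Eu N) (ENNReal.ofReal p) (volume.restrict Ω)) where
  carrier := {z | ∃ φ, IsTestFunction U φ ∧ z.1 =ᵐ[volume.restrict Ω] φ ∧
    z.2 =ᵐ[volume.restrict Ω] ∇ φ}
  add_mem' := by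
    rintro z w ⟨φ, h1, h2, h3⟩ ⟨ψ, k1, k2, k3⟩
    exact ⟨φ + ψ, h1.add k1, (Lp.coeFn_add _ _).trans (h2.add k2),
      by rw [h1.gradient_add k1]; exact (Lp.coeFn_add _ _).trans (h3.add k3)⟩
  zero_mem' := ⟨0, IsTestFunction.zero U, Lp.coeFn_zero _ _ _, by
    have : ∇ (0 : Eu N → ℝ) = 0 := by ext1 x; simp [gradient]
    rw [this]; exact Lp.coeFn_zero _ _ _⟩
  smul_mem' := by
    rintro t z ⟨φ, h1, h2, h3⟩
    exact ⟨t • φ, h1.smul t, (Lp.coeFn_smul _ _).trans (h2.const_smul t),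
      by rw [h1.gradient_smul t]; exact (Lp.coeFn_smul _ _).trans (h3.const_smul t)⟩

/-- The closure of `C_c^∞(U)` in `W^{1,p}(Ω)`, as a space of pairs `(u, ∇u)`. -/
def sobolevClosure : Submodule ℝ
    (Lp ℝ (ENNReal.ofReal p) (volume.restrict Ω) × Lp (Eu N) (ENNReal.ofReal p) (volume.restrict Ω)) :=
  (testSubmodule p Ω U).topologicalClosure

variable {p Ω U}

theorem IsTestFunction.mem_sobolevClosure {φ : Eu N → ℝ} (hφ : IsTestFunction U φ) :
    ((hφ.memLp _ Ω).toLp φ, (hφ.memLp_gradient _ Ω).toLp (∇ φ)) ∈ sobolevClosure p Ω U :=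
  Submodule.le_topologicalClosure _ ⟨φ, hφ, (hφ.memLp _ Ω).coeFn_toLp,
    (hφ.memLp_gradient _ Ω).coeFn_toLp⟩

theorem MemW1pClosure.mem_sobolevClosure {u : Eu N → ℝ} {g : Eu N → Eu N}
    (h : MemW1pClosure p Ω U u g) :
    (h.1.1.toLp u, h.1.2.1.toLp g) ∈ sobolevClosure p Ω U := by
  obtain ⟨φ, hφ, h1, h2⟩ := h.2
  have t1 := (Lp.tendsto_Lp_iff_tendsto_eLpNorm'' (fun k => φ k) (fun k => (hφ k).memLp _ Ω) u
    h.1.1).2 (h1.congr fun k => eLpNorm_sub_comm u (φ k) _ _)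
  have t2 := (Lp.tendsto_Lp_iff_tendsto_eLpNorm'' (fun k => ∇ (φ k))
    (fun k => (hφ k).memLp_gradient _ Ω) g h.1.2.1).2
    (h2.congr fun k => eLpNorm_sub_comm g (∇ (φ k)) _ _)
  exact (Submodule.isClosed_topologicalClosure _).mem_of_tendsto (t1.prodMk_nhds t2)
    (Eventually.of_forall fun k => (hφ k).mem_sobolevClosure)

/-- For a fixed test function and coordinate, the identity defining a weak gradient equates two
continuous functionals of the pair, so it survives passage to the closure. -/
theorem hasWeakGradient_of_mem_sobolevClosure [IsFiniteMeasure (volume.restrict Ω)]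
    {z : Lp ℝ (ENNReal.ofReal p) (volume.restrict Ω) × Lp (Eu N) (ENNReal.ofReal p) (volume.restrict Ω)}
    (hz : z ∈ sobolevClosure p Ω U) : HasWeakGradient Ω z.1 z.2 := by
  intro ψ hψ i
  have hbd {f : Eu N → ℝ} (hf : Continuous f) (hc : HasCompactSupport f) : ∃ K, ∀ x, |f x| ≤ K :=
    hc.exists_bound_of_continuous hf
  have hci : Continuous fun x => ∇ ψ x i :=
    (EuclideanSpace.proj (𝕜 := ℝ) i).continuous.comp hψ.continuous_gradient
  obtain ⟨K₁, hK₁⟩ := hbd hψ.continuous hψ.2.1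
  obtain ⟨K₂, hK₂⟩ := hbd hci (hψ.hasCompactSupport_gradient.comp_left
    (g := fun v : Eu N => v i) (by simp))
  obtain ⟨T₁, hT₁⟩ := exists_clm_integral_mul (μ := volume.restrict Ω) (q := ENNReal.ofReal p)
    hψ.continuous.aestronglyMeasurable hK₁
  obtain ⟨T₂, hT₂⟩ := exists_clm_integral_mul (μ := volume.restrict Ω) (q := ENNReal.ofReal p)
    hci.aestronglyMeasurable hK₂
  let π : Eu N →L[ℝ] ℝ := EuclideanSpace.proj i
  let L := π.compLpL (ENNReal.ofReal p)
    (volume.restrict Ω)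
  have hL (w : Lp (Eu N) (ENNReal.ofReal p) (volume.restrict Ω)) :
      T₁ (L w) = ∫ x in Ω, w x i * ψ x := by
    rw [hT₁]
    refine integral_congr_ae ?_
    filter_upwards [π.coeFn_compLpL w] with x hx
    simp [L, hx, π]
  have hclosed : IsClosed {w : Lp ℝ (ENNReal.ofReal p) (volume.restrict Ω) ×
      Lp (Eu N) (ENNReal.ofReal p) (volume.restrict Ω) | T₂ w.1 = -T₁ (L w.2)} :=
    isClosed_eq (T₂.continuous.comp continuous_fst)
      ((T₁.continuous.comp (L.continuous.comp continuous_snd)).neg)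
  have hsub : (testSubmodule p Ω U : Set _) ⊆ {w : Lp ℝ (ENNReal.ofReal p) (volume.restrict Ω) ×
      Lp (Eu N) (ENNReal.ofReal p) (volume.restrict Ω) | T₂ w.1 = -T₁ (L w.2)} := by
    rintro w ⟨φ, h1, h2, h3⟩
    have h := h1.hasWeakGradient Ω ψ hψ i
    rw [mem_ofPred_eq, hT₂, hL]
    convert h using 1
    · refine integral_congr_ae ?_
      filter_upwards [h2] with x hx
      rw [hx]
    · congr 1
      refine integral_congr_ae ?_
      filter_upwards [h3] with x hx
      rw [hx]
  have := closure_minimal hsub hclosed hz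
  rwa [mem_ofPred_eq, hT₂, hL] at this

/-- Together with `MemW1pClosure.mem_sobolevClosure` this identifies the concrete Sobolev space with
a closed, hence complete, subspace. -/
theorem memW1pClosure_of_mem_sobolevClosure [IsFiniteMeasure (volume.restrict Ω)]
    {z : Lp ℝ (ENNReal.ofReal p) (volume.restrict Ω) × Lp (Eu N) (ENNReal.ofReal p) (volume.restrict Ω)}
    (hz : z ∈ sobolevClosure p Ω U) : MemW1pClosure p Ω U z.1 z.2 := by
  refine ⟨⟨Lp.memLp _, Lp.memLp _, hasWeakGradient_of_mem_sobolevClosure hz⟩, ?_⟩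
  obtain ⟨w, hw, hlim⟩ := mem_closure_iff_seq_limit.1 hz
  choose φ h1 h2 h3 using hw
  refine ⟨φ, h1, ?_, ?_⟩
  · refine ((Lp.tendsto_Lp_iff_tendsto_eLpNorm' (fun k => (w k).1) z.1).1
      ((continuous_fst.tendsto z).comp hlim)).congr fun k => ?_
    rw [eLpNorm_sub_comm]
    refine eLpNorm_congr_ae ?_
    filter_upwards [h2 k] with x hx
    simp [hx]
  · refine ((Lp.tendsto_Lp_iff_tendsto_eLpNorm' (fun k => (w k).2) z.2).1
      ((continuous_snd.tendsto z).comp hlim)).congr fun k => ?_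
    rw [eLpNorm_sub_comm]
    refine eLpNorm_congr_ae ?_
    filter_upwards [h3 k] with x hx
    simp [hx]

end Closure

/-! ### Compact embedding into `L^p` by cell averages. -/

section Compactness

variable {N : ℕ}

/-- The cells are the traces on `Q` of half-open grid cubes of side `δ`, indexed by integer parts;
boundedness of `Q` leaves finitely many relevant indices. -/
theorem exists_finite_convex_partition {Q : Set (Eu N)} (hQ : Convex ℝ Q) (hQm : MeasurableSet Q)
    (hQb : Bornology.IsBounded Q) {δ : ℝ} (hδ : 0 < δ) :
    ∃ (I : Finset (Fin N → ℤ)) (C : (Fin N → ℤ) → Set (Eu N)),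
      (∀ j, Convex ℝ (C j)) ∧ (∀ j, MeasurableSet (C j)) ∧ (∀ j, C j ⊆ Q) ∧
      Pairwise (Function.onFun Disjoint C) ∧ (∀ j, ∀ x ∈ C j, ∀ y ∈ C j, ‖y - x‖ ≤ √N * δ) ∧
      Q = ⋃ j ∈ I, C j := by
  obtain ⟨R, hR⟩ := hQb.exists_norm_le
  refine ⟨Fintype.piFinset fun _ => Finset.Icc ⌊-R / δ⌋ ⌊R / δ⌋,
    fun j => Q ∩ {x | ∀ i, ⌊x i / δ⌋ = j i}, fun j => hQ.inter ?_, fun j => hQm.inter ?_,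
    fun j => inter_subset_left, ?_, ?_, ?_⟩
  · intro x hx y hy a b ha hb hab i
    have h1 := Int.floor_eq_iff.1 (hx i)
    have h2 := Int.floor_eq_iff.1 (hy i)
    have h3 := convex_Ico (j i : ℝ) (j i + 1) h1 h2 ha hb hab
    rw [Int.floor_eq_iff]
    have e : (a • x + b • y) i / δ = a • (x i / δ) + b • (y i / δ) := by
      simp only [PiLp.add_apply, PiLp.smul_apply, smul_eq_mul]; ring
    rw [e]
    exact h3
  · rw [ofPred_forall]
    refine MeasurableSet.iInter fun i => ?_
    have hm : Measurable fun x : Eu N => ⌊x i / δ⌋ :=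
      Int.measurable_floor.comp (by fun_prop)
    exact hm (measurableSet_singleton (j i))
  · intro j k hjk
    refine Set.disjoint_left.2 fun x hx hy => hjk ?_
    ext i
    rw [← hx.2 i, ← hy.2 i]
  · intro j x hx y hy
    rw [EuclideanSpace.norm_eq]
    refine Real.sqrt_le_iff.2 ⟨by positivity, ?_⟩
    rw [mul_pow, Real.sq_sqrt (Nat.cast_nonneg _)]
    calc ∑ i, ‖(y - x) i‖ ^ 2 ≤ ∑ _i : Fin N, δ ^ 2 := by
          refine Finset.sum_le_sum fun i _ => ?_
          have h1 := Int.floor_eq_iff.1 (hx.2 i)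
          have h2 := Int.floor_eq_iff.1 (hy.2 i)
          rw [le_div_iff₀ hδ, div_lt_iff₀ hδ] at h1 h2
          rw [PiLp.sub_apply, Real.norm_eq_abs]
          exact pow_le_pow_left₀ (abs_nonneg _) (abs_le.2 ⟨by linarith, by linarith⟩) 2
      _ = N * δ ^ 2 := by simp
  · ext x
    simp only [mem_iUnion, mem_inter_iff, mem_ofPred_eq, Fintype.mem_piFinset, Finset.mem_Icc,
      exists_prop]
    refine ⟨fun hx => ⟨fun i => ⌊x i / δ⌋, fun i => ?_, hx, fun i => rfl⟩, fun ⟨j, _, h, _⟩ => h⟩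
    have h1 : |x i| ≤ R := (PiLp.norm_apply_le x i).trans (hR x hx)
    rw [abs_le] at h1
    exact ⟨Int.floor_le_floor (div_le_div_of_nonneg_right h1.1 hδ.le),
      Int.floor_le_floor (div_le_div_of_nonneg_right h1.2 hδ.le)⟩

theorem coeFn_sum_smul_indicatorConstLp {α ι : Type*} [MeasurableSpace α] {μ : Measure α}
    [IsFiniteMeasure μ] {q : ENNReal} (I : Finset ι) (a : ι → ℝ) {C : ι → Set α}
    (hC : ∀ j, MeasurableSet (C j)) :
    ⇑(∑ j ∈ I, a j • indicatorConstLp q (hC j) (measure_ne_top μ (C j)) (1 : ℝ)) =ᵐ[μ]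
      fun x => ∑ j ∈ I, (C j).indicator (fun _ => a j) x := by
  classical
  induction I using Finset.induction_on with
  | empty => simp only [Finset.sum_empty]; exact Lp.coeFn_zero ℝ q μ
  | insert j I hj ih =>
    simp only [Finset.sum_insert hj]
    filter_upwards [ih, Lp.coeFn_add (a j • indicatorConstLp q (hC j) (measure_ne_top μ (C j)) (1 : ℝ))
      (∑ j ∈ I, a j • indicatorConstLp q (hC j) (measure_ne_top μ (C j)) (1 : ℝ)),
      Lp.coeFn_smul (a j) (indicatorConstLp q (hC j) (measure_ne_top μ (C j)) (1 : ℝ)),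
      indicatorConstLp_coeFn (p := q) (hs := hC j) (hμs := measure_ne_top μ (C j)) (c := (1 : ℝ))]
      with x h1 h2 h3 h4
    rw [h2, Pi.add_apply, h1, h3, Pi.smul_apply, h4]
    by_cases hx : x ∈ C j <;> simp [hx]

theorem isCompactOperator_sum_smulRight {ι X Y : Type*} [NormedAddCommGroup X] [NormedSpace ℝ X]
    [NormedAddCommGroup Y] [NormedSpace ℝ Y] (I : Finset ι) (S : ι → X →L[ℝ] ℝ) (e : ι → Y) :
    IsCompactOperator (∑ j ∈ I, (S j).smulRight (e j) : X →L[ℝ] Y) := by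
  classical
  induction I using Finset.induction_on with
  | empty => simpa using isCompactOperator_zero
  | insert j I hj ih =>
    rw [Finset.sum_insert hj]
    exact ((isCompactOperator_of_locallyCompactSpace_dom (S j)).clm_comp
      (ContinuousLinearMap.toSpanSingleton ℝ (e j))).add ih

variable {p : ℝ} {Q U : Set (Eu N)}

/-- The Poincaré inequality is applied on whole cells of `Q`, which may leave `U`. This is harmless
since `φ` is smooth everywhere and `∇ φ` vanishes off `U`, so `U` needs neither convexity nor a
regular boundary. -/
theorem eLpNorm_sub_cellAverage_le (hp : 1 < p) (hQb : Bornology.IsBounded Q)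
    (hU : MeasurableSet U) {ι : Type*} (I : Finset ι) {C : ι → Set (Eu N)}
    (hC : ∀ j, Convex ℝ (C j)) (hCm : ∀ j, MeasurableSet (C j)) (hCQ : ∀ j, C j ⊆ Q)
    (hCd : Pairwise (Function.onFun Disjoint C)) {δ : ℝ}
    (hδ : ∀ j, ∀ x ∈ C j, ∀ y ∈ C j, ‖y - x‖ ≤ δ) (hQC : Q = ⋃ j ∈ I, C j)
    {φ : Eu N → ℝ} (hφ : IsTestFunction U φ) :
    eLpNorm (fun x => φ x - ∑ j ∈ I, (C j).indicator (fun _ => ⨍ y in C j, φ y) x)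
      (ENNReal.ofReal p) (volume.restrict (Q ∩ U)) ≤
      ENNReal.ofReal δ * 2 ^ N * eLpNorm (∇ φ) (ENNReal.ofReal p) (volume.restrict (Q ∩ U)) := by
  have hp0 : 0 < p := by linarith
  rw [eLpNorm_eq_lintegral_rpow_enorm_toReal (by simpa using hp0) (by simp),
    eLpNorm_eq_lintegral_rpow_enorm_toReal (by simpa using hp0) (by simp),
    ENNReal.toReal_ofReal hp0.le]
  have hK : ENNReal.ofReal δ * 2 ^ N = ((ENNReal.ofReal δ * 2 ^ N) ^ p) ^ (1 / p) := by
    rw [← ENNReal.rpow_mul, mul_one_div_cancel hp0.ne', ENNReal.rpow_one]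
  rw [hK, ← ENNReal.mul_rpow_of_nonneg _ _ (by positivity)]
  gcongr
  have hd : (I : Set ι).PairwiseDisjoint C := fun j _ k _ hjk => hCd hjk
  calc ∫⁻ x in Q ∩ U, ‖φ x - ∑ j ∈ I, (C j).indicator (fun _ => ⨍ y in C j, φ y) x‖ₑ ^ p
      ≤ ∫⁻ x in Q, ‖φ x - ∑ j ∈ I, (C j).indicator (fun _ => ⨍ y in C j, φ y) x‖ₑ ^ p :=
        lintegral_mono_set inter_subset_left
    _ = ∑ k ∈ I, ∫⁻ x in C k, ‖φ x - ∑ j ∈ I, (C j).indicator (fun _ => ⨍ y in C j, φ y) x‖ₑ ^ p := by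
        conv_lhs => rw [hQC]
        exact lintegral_biUnion_finset hd (fun j _ => hCm j) _
    _ = ∑ k ∈ I, ∫⁻ x in C k, ‖φ x - ⨍ y in C k, φ y‖ₑ ^ p := by
        refine Finset.sum_congr rfl fun k hk => setLIntegral_congr_fun (hCm k) fun x hx => ?_
        rw [Finset.sum_eq_single_of_mem k hk, indicator_of_mem hx]
        intro j _ hjk
        exact indicator_of_notMem (fun h => Set.disjoint_left.1 (hCd hjk) h hx) _
    _ ≤ ∑ k ∈ I, (ENNReal.ofReal δ * 2 ^ N) ^ p * ∫⁻ x in C k, ‖∇ φ x‖ₑ ^ p := by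
        refine Finset.sum_le_sum fun k _ => ?_
        refine (lintegral_enorm_sub_average_rpow_le (hC k) (hCm k) (hQb.subset (hCQ k)) hp (hδ k)
          hφ.contDiff_one).trans ?_
        rw [ENNReal.mul_rpow_of_nonneg _ _ hp0.le]
        gcongr
        -- The constant is enlarged to `(2 ^ N) ^ p` so that it comes out cleanly after the `p`-th
        -- root.
        calc (2 : ENNReal) ^ N = ((2 : ENNReal) ^ N) ^ (1 : ℝ) := (ENNReal.rpow_one _).symm
          _ ≤ _ := ENNReal.rpow_le_rpow_of_exponent_le (one_le_pow₀ (by norm_num)) hp.le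
    _ = (ENNReal.ofReal δ * 2 ^ N) ^ p * ∫⁻ x in Q, ‖∇ φ x‖ₑ ^ p := by
        rw [← Finset.mul_sum, ← lintegral_biUnion_finset hd (fun j _ => hCm j), ← hQC]
    _ = (ENNReal.ofReal δ * 2 ^ N) ^ p * ∫⁻ x in Q ∩ U, ‖∇ φ x‖ₑ ^ p := by
        have hz : ∫⁻ x in Q \ U, ‖∇ φ x‖ₑ ^ p = 0 := by
          rw [lintegral_eq_zero_iff (hφ.continuous_gradient.enorm.measurable.pow_const p)]
          have hQm : MeasurableSet Q := by
            rw [hQC]; exact Finset.measurableSet_biUnion _ fun j _ => hCm j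
          filter_upwards [ae_restrict_mem (hQm.diff hU)] with x hx
          simp [hφ.gradient_eq_zero hx.2, hp0]
        rw [← lintegral_inter_add_sdiff _ Q hU, hz, add_zero]

/-- The operator `T` replaces a function by its cell averages and has finite rank. The estimate is
proved for test functions and is a closed condition on pairs. -/
theorem exists_isCompactOperator_approx [Fact (1 ≤ ENNReal.ofReal p)] (hp : 1 < p) (hQ : Convex ℝ Q) (hQm : MeasurableSet Q)
    (hQb : Bornology.IsBounded Q) (hU : MeasurableSet U) {δ : ℝ} (hδ : 0 < δ) :
    ∃ T : Lp ℝ (ENNReal.ofReal p) (volume.restrict (Q ∩ U)) →L[ℝ]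
        Lp ℝ (ENNReal.ofReal p) (volume.restrict (Q ∩ U)),
      IsCompactOperator T ∧ ∀ z ∈ sobolevClosure p (Q ∩ U) U, ‖z.1 - T z.1‖ ≤ δ * ‖z.2‖ := by
  have : IsFiniteMeasure (volume.restrict (Q ∩ U)) :=
    ⟨by simpa using (hQb.subset inter_subset_left).measure_lt_top⟩
  set μ := volume.restrict (Q ∩ U) with hμ
  obtain ⟨I, C, hC, hCm, hCQ, hCd, hCδ, hQC⟩ := exists_finite_convex_partition hQ hQm hQb
    -- The mesh absorbs the cell diameter factor `√N` and the Poincaré constant `2 ^ N`; the `+ 1`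
    -- keeps it meaningful for `N = 0`.
    (δ := δ / (2 ^ N * (√N + 1))) (by positivity)
  have hT (j : Fin N → ℤ) : ∃ T : Lp ℝ (ENNReal.ofReal p) μ →L[ℝ] ℝ,
      ∀ u, T u = ∫ x, u x * (C j).indicator (fun _ => (1 : ℝ)) x ∂μ :=
    exists_clm_integral_mul (K := 1)
      (aestronglyMeasurable_const.indicator (hCm j)) fun x => by
        by_cases hx : x ∈ C j <;> simp [hx]
  choose S hS using hT
  set e : (Fin N → ℤ) → Lp ℝ (ENNReal.ofReal p) μ := fun j =>
    indicatorConstLp (ENNReal.ofReal p) (hCm j) (measure_ne_top μ (C j)) (1 : ℝ) with he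
  set T : Lp ℝ (ENNReal.ofReal p) μ →L[ℝ] Lp ℝ (ENNReal.ofReal p) μ :=
    ∑ j ∈ I, ((volume.real (C j))⁻¹ • S j).smulRight (e j) with hTdef
  refine ⟨T, ?_, ?_⟩
  · exact isCompactOperator_sum_smulRight I (fun j => (volume.real (C j))⁻¹ • S j) e
  · have hclosed : IsClosed {z : Lp ℝ (ENNReal.ofReal p) μ × Lp (Eu N) (ENNReal.ofReal p) μ |
        ‖z.1 - T z.1‖ ≤ δ * ‖z.2‖} :=
      isClosed_le ((continuous_fst.sub (T.continuous.comp continuous_fst)).norm)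
        (continuous_const.mul continuous_snd.norm)
    have hsub : (testSubmodule p (Q ∩ U) U : Set _) ⊆
        {z : Lp ℝ (ENNReal.ofReal p) μ × Lp (Eu N) (ENNReal.ofReal p) μ |
          ‖z.1 - T z.1‖ ≤ δ * ‖z.2‖} := by
      rintro w ⟨φ, hφ, h1, h2⟩
      have hTw : T w.1 =ᵐ[μ] fun x => ∑ j ∈ I, (C j).indicator (fun _ => ⨍ y in C j, φ y) x := by
        have : T w.1 = ∑ j ∈ I, (⨍ y in C j, φ y) • e j := by
          simp only [hTdef, sum_apply, ContinuousLinearMap.smulRight_apply]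
          refine Finset.sum_congr rfl fun j _ => ?_
          congr 1
          rw [smul_apply, hS, setAverage_eq]
          congr 1
          calc ∫ x, w.1 x * (C j).indicator (fun _ => (1 : ℝ)) x ∂μ
              = ∫ x in Q ∩ U, (C j).indicator φ x := by
                refine integral_congr_ae ?_
                filter_upwards [h1] with x hx
                by_cases hxC : x ∈ C j <;> simp [hxC, hx]
            -- The part of the cell outside `U` contributes nothing, so integrating over `Q ∩ U`
            -- yields the average over the full cell.
            _ = ∫ x, (C j).indicator φ x := by
                refine setIntegral_eq_integral_of_forall_compl_eq_zero fun x hx => ?_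
                by_cases hxC : x ∈ C j
                · rw [indicator_of_mem hxC]
                  exact hφ.eq_zero fun h => hx ⟨hCQ j hxC, h⟩
                · simp [hxC]
            _ = ∫ x in C j, φ x := integral_indicator (hCm j)
        rw [this]
        exact coeFn_sum_smul_indicatorConstLp I _ hCm
      have hle := eLpNorm_sub_cellAverage_le (p := p) hp hQb hU I hC hCm hCQ hCd hCδ hQC hφ
      have e1 : eLpNorm (w.1 - T w.1 : Lp ℝ (ENNReal.ofReal p) μ) (ENNReal.ofReal p) μ =
          eLpNorm (fun x => φ x - ∑ j ∈ I, (C j).indicator (fun _ => ⨍ y in C j, φ y) x)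
            (ENNReal.ofReal p) μ := by
        refine eLpNorm_congr_ae ?_
        filter_upwards [Lp.coeFn_sub w.1 (T w.1), h1, hTw] with x k1 k2 k3
        rw [k1, Pi.sub_apply, k2, k3]
      rw [← hμ, ← e1, ← eLpNorm_congr_ae h2] at hle
      rw [mem_ofPred_eq, Lp.norm_def, Lp.norm_def]
      refine (ENNReal.toReal_mono ?_ hle).trans ?_
      · exact ENNReal.mul_ne_top (ENNReal.mul_ne_top ENNReal.ofReal_ne_top (by simp))
          (Lp.eLpNorm_ne_top _)
      · rw [ENNReal.toReal_mul, ENNReal.toReal_mul, ENNReal.toReal_ofReal (by positivity),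
          ENNReal.toReal_pow, ENNReal.toReal_ofNat]
        refine mul_le_mul_of_nonneg_right ?_ ENNReal.toReal_nonneg
        have h0 : 0 ≤ √(N : ℝ) := Real.sqrt_nonneg _
        rw [show √N * (δ / (2 ^ N * (√N + 1))) * 2 ^ N = δ * (√N / (√N + 1)) by field_simp]
        exact mul_le_of_le_one_right hδ.le ((div_le_one (by positivity)).2 (by linarith))
    exact fun z hz => closure_minimal hsub hclosed hz

/-- The embedding into `L^p` of a space `V ⊆ L^p × L^p` of pairs `(u, ∇u)`. -/
def sobolevEmbedding (p : ℝ) [Fact (1 ≤ ENNReal.ofReal p)] (Ω U : Set (Eu N)) :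
    sobolevClosure p Ω U →L[ℝ] Lp ℝ (ENNReal.ofReal p) (volume.restrict Ω) :=
  (ContinuousLinearMap.fst ℝ _ _).comp (sobolevClosure p Ω U).subtypeL

/-- A version of the Rellich–Kondrachov theorem: the functions vanish on the part of the boundary of
`Q ∩ U` which lies inside the convex set `Q`. -/
theorem isCompactOperator_sobolevEmbedding [Fact (1 ≤ ENNReal.ofReal p)] (hp : 1 < p) (hQ : Convex ℝ Q) (hQm : MeasurableSet Q)
    (hQb : Bornology.IsBounded Q) (hU : MeasurableSet U)
    {Ω : Set (Eu N)} (hΩ : Ω = Q ∩ U) : IsCompactOperator (sobolevEmbedding p Ω U) := by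
  subst hΩ
  choose T hT hTle using fun k : ℕ => exists_isCompactOperator_approx (p := p) hp hQ hQm hQb hU
    (δ := 1 / ((k : ℝ) + 1)) Nat.one_div_pos_of_nat
  refine isCompactOperator_of_tendsto (l := atTop)
    (F := fun k => (T k).comp (sobolevEmbedding p (Q ∩ U) U)) ?_
    (Eventually.of_forall fun k => (hT k).comp_clm _)
  rw [tendsto_iff_norm_sub_tendsto_zero]
  refine squeeze_zero (fun _ => norm_nonneg _) (fun k => ?_)
    (tendsto_one_div_add_atTop_nhds_zero_nat (𝕜 := ℝ))
  refine ContinuousLinearMap.opNorm_le_bound _ (by positivity) fun z => ?_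
  have h1 := hTle k z.1 z.2
  rw [norm_sub_rev] at h1
  refine h1.trans (mul_le_mul_of_nonneg_left ?_ (by positivity))
  exact norm_snd_le z.1

end Compactness

/-! ### Minimizers of the Rayleigh quotient and the Euler–Lagrange equation. -/

section Eigenvalue

variable {N : ℕ} {p M c : ℝ} [Fact (1 ≤ ENNReal.ofReal p)] {Ω U : Set (Eu N)}
  {B : Eu N → Matrix (Fin N) (Fin N) ℝ}

/-- The function `t ↦ energy(z + t w) - lam ‖z + t w‖ ^ p` is nonnegative and vanishes at `t = 0`,
so its derivative there is zero. The homogeneous form of the minimality makes a Lagrange multiplier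
unnecessary. -/
theorem eulerLagrange_of_minimizer (hp : 2 ≤ p) (hB : IsEllipticField (volume.restrict Ω) M c B)
    {lam : ℝ} {z w : Lp ℝ (ENNReal.ofReal p) (volume.restrict Ω) ×
      Lp (Eu N) (ENNReal.ofReal p) (volume.restrict Ω)}
    (hz : z ∈ sobolevClosure p Ω U) (hw : w ∈ sobolevClosure p Ω U)
    (hmin : ∀ w ∈ sobolevClosure p Ω U, lam * ‖w.1‖ ^ p ≤ energy (volume.restrict Ω) B p w.2)
    (heq : energy (volume.restrict Ω) B p z.2 = lam * ‖z.1‖ ^ p) :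
    ∫ x in Ω, |form (B x) (z.2 x) (z.2 x)| ^ ((p - 2) / 2) * form (B x) (z.2 x) (w.2 x)
      = lam * ∫ x in Ω, |z.1 x| ^ (p - 2) * z.1 x * w.1 x := by
  have hp0 : 0 < p := by linarith
  set K := √(M + 1) with hKdef
  have hM := hB.nonneg
  have hK : K ^ 2 = M + 1 := Real.sq_sqrt (by linarith)
  have hbound {b : Matrix (Fin N) (Fin N) ℝ} (hb : IsEllipticMatrix M c b) {ξ η : Eu N} {r : ℝ}
      (hξ : ‖ξ‖ ≤ r) (hη : ‖η‖ ≤ r) : |form b ξ η| ≤ (K * r) ^ 2 := by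
    refine (hb.abs_form_le ξ η).trans ?_
    rw [mul_pow, hK, mul_assoc, pow_two]
    have h1 := norm_nonneg ξ
    exact mul_le_mul (by linarith) (mul_le_mul hξ hη (norm_nonneg _) (h1.trans hξ))
      (by positivity) (by linarith)
  have hz2 := Lp.memLp z.2
  have hw2 := Lp.memLp w.2
  have hz1 := Lp.memLp z.1
  have hw1 := Lp.memLp w.1
  have d1 := hasDerivAt_integral_quadratic_rpow (μ := volume.restrict Ω) hp
    (a := fun x => form (B x) (z.2 x) (z.2 x)) (b := fun x => form (B x) (z.2 x) (w.2 x))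
    (q := fun x => form (B x) (w.2 x) (w.2 x)) (G := fun x => K * (‖z.2 x‖ + ‖w.2 x‖))
    (aestronglyMeasurable_form hB.measurable hz2.1 hz2.1)
    (aestronglyMeasurable_form hB.measurable hz2.1 hw2.1)
    (aestronglyMeasurable_form hB.measurable hw2.1 hw2.1)
    ((hz2.norm.add hw2.norm).const_mul K)
    (by
      filter_upwards [hB.ae_elliptic] with x hx
      exact hbound hx (by linarith [norm_nonneg (w.2 x)]) (by linarith [norm_nonneg (w.2 x)]))
    (by
      filter_upwards [hB.ae_elliptic] with x hx
      exact hbound hx (by linarith [norm_nonneg (w.2 x)]) (by linarith [norm_nonneg (z.2 x)]))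
    (by
      filter_upwards [hB.ae_elliptic] with x hx
      exact hbound hx (by linarith [norm_nonneg (z.2 x)]) (by linarith [norm_nonneg (z.2 x)]))
    (by
      filter_upwards [hB.ae_elliptic] with x hx t
      rw [← hx.form_add_smul_self]
      exact hx.form_self_nonneg hB.pos.le _)
  -- The `L^p` norm falls under the same lemma, since `|z + t w| ^ p` is the `p/2`-th power of the
  -- square `(z + t w)²`.
  have d2 := hasDerivAt_integral_quadratic_rpow (μ := volume.restrict Ω) hp
    (a := fun x => z.1 x ^ 2) (b := fun x => z.1 x * w.1 x)
    (q := fun x => w.1 x ^ 2) (G := fun x => ‖z.1 x‖ + ‖w.1 x‖)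
    (hz1.1.pow 2) (hz1.1.mul hw1.1) (hw1.1.pow 2) (hz1.norm.add hw1.norm)
    (Eventually.of_forall fun x => by
      rw [abs_pow, Real.norm_eq_abs, Real.norm_eq_abs]
      nlinarith [abs_nonneg (z.1 x), abs_nonneg (w.1 x)])
    (Eventually.of_forall fun x => by
      rw [abs_mul, Real.norm_eq_abs, Real.norm_eq_abs]
      nlinarith [abs_nonneg (z.1 x), abs_nonneg (w.1 x)])
    (Eventually.of_forall fun x => by
      rw [abs_pow, Real.norm_eq_abs, Real.norm_eq_abs]
      nlinarith [abs_nonneg (z.1 x), abs_nonneg (w.1 x)])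
    (Eventually.of_forall fun x t => by nlinarith [sq_nonneg (z.1 x + t * w.1 x)])
  have e1 (t : ℝ) : ∫ x, (form (B x) (z.2 x) (z.2 x) + 2 * t * form (B x) (z.2 x) (w.2 x)
      + t ^ 2 * form (B x) (w.2 x) (w.2 x)) ^ (p / 2) ∂(volume.restrict Ω) = energy (volume.restrict Ω) B p (z + t • w).2 := by
    refine integral_congr_ae ?_
    filter_upwards [hB.ae_elliptic, Lp.coeFn_add z.2 (t • w.2), Lp.coeFn_smul t w.2] with x hx h1 h2
    rw [Prod.snd_add, Prod.smul_snd, h1, Pi.add_apply, h2, Pi.smul_apply, hx.form_add_smul_self]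
  have e2 (t : ℝ) : ∫ x, (z.1 x ^ 2 + 2 * t * (z.1 x * w.1 x)
      + t ^ 2 * w.1 x ^ 2) ^ (p / 2) ∂(volume.restrict Ω) = ‖(z + t • w).1‖ ^ p := by
    rw [← integral_abs_rpow_eq_norm hp0]
    refine integral_congr_ae ?_
    filter_upwards [Lp.coeFn_add z.1 (t • w.1), Lp.coeFn_smul t w.1] with x h1 h2
    rw [Prod.fst_add, Prod.smul_fst, h1, Pi.add_apply, h2, Pi.smul_apply, smul_eq_mul,
      Real.norm_eq_abs, ← Real.sqrt_sq_eq_abs, sqrt_rpow_eq_rpow_half (sq_nonneg _)]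
    congr 1
    ring
  simp only [e1] at d1
  simp only [e2] at d2
  have hloc : IsLocalMin
      (fun t : ℝ => energy (volume.restrict Ω) B p (z + t • w).2 - lam * ‖(z + t • w).1‖ ^ p) 0 := by
    refine Eventually.of_forall fun t => ?_
    have h1 := hmin (z + t • w) (Submodule.add_mem _ hz (Submodule.smul_mem _ t hw))
    simp only [zero_smul, add_zero]
    rw [heq]
    linarith
  have hd := hloc.hasDerivAt_eq_zero (d1.sub (d2.const_mul lam))
  have h3 : ∫ x, form (B x) (z.2 x) (z.2 x) ^ ((p - 2) / 2) * form (B x) (z.2 x) (w.2 x) ∂(volume.restrict Ω)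
      = lam * ∫ x, (z.1 x ^ 2) ^ ((p - 2) / 2) * (z.1 x * w.1 x) ∂(volume.restrict Ω) := by
    refine mul_left_cancel₀ hp0.ne' ?_
    linarith
  calc ∫ x, |form (B x) (z.2 x) (z.2 x)| ^ ((p - 2) / 2) * form (B x) (z.2 x) (w.2 x) ∂(volume.restrict Ω)
      = ∫ x, form (B x) (z.2 x) (z.2 x) ^ ((p - 2) / 2) * form (B x) (z.2 x) (w.2 x) ∂(volume.restrict Ω) := by
        refine integral_congr_ae ?_
        filter_upwards [hB.ae_elliptic] with x hx
        rw [abs_of_nonneg (hx.form_self_nonneg hB.pos.le _)]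
    _ = _ := by
        rw [h3]
        congr 1
        refine integral_congr_ae (Eventually.of_forall fun x => ?_)
        simp only
        rw [← sqrt_rpow_eq_rpow_half (sq_nonneg _), Real.sqrt_sq_eq_abs, mul_assoc]

theorem exists_minimizer_energy (hp : 2 ≤ p) (hB : IsEllipticField (volume.restrict Ω) M c B)
    (hcomp : IsCompactOperator (sobolevEmbedding p Ω U))
    (hne : ∃ z ∈ sobolevClosure p Ω U, z.1 ≠ 0) :
    ∃ z ∈ sobolevClosure p Ω U, ‖z.1‖ = 1 ∧ ∀ w ∈ sobolevClosure p Ω U,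
      energy (volume.restrict Ω) B p z.2 * ‖w.1‖ ^ p ≤ energy (volume.restrict Ω) B p w.2 := by
  have hp0 : 0 < p := by linarith
  have hc := hB.pos
  have : CompleteSpace (sobolevClosure p Ω U) :=
    (Submodule.isClosed_topologicalClosure _).completeSpace_coe
  let J : sobolevClosure p Ω U → ℝ := fun z => energy (volume.restrict Ω) B p z.1.2
  have hJc : Continuous J :=
    (hB.continuous_energy (by linarith)).comp (continuous_snd.comp continuous_subtype_val)
  have hom (t : ℝ) (z : sobolevClosure p Ω U) : J (t • z) = |t| ^ p * J z := by
    refine Eq.trans ?_ (hB.energy_smul t z.1.2)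
    exact energy_congr (Lp.coeFn_smul t z.1.2)
  have hclark (x y : sobolevClosure p Ω U) :
      J ((2 : ℝ)⁻¹ • (x - y)) + J ((2 : ℝ)⁻¹ • (x + y)) ≤ (J x + J y) / 2 := by
    refine le_trans (le_of_eq ?_) (hB.energy_clarkson hp (Lp.memLp x.1.2) (Lp.memLp y.1.2))
    congr 1
    · refine energy_congr ?_
      filter_upwards [Lp.coeFn_smul (2 : ℝ)⁻¹ (x.1.2 - y.1.2), Lp.coeFn_sub x.1.2 y.1.2] with a k1 k2
      refine k1.trans ?_
      rw [Pi.smul_apply, k2, Pi.sub_apply]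
    · refine energy_congr ?_
      filter_upwards [Lp.coeFn_smul (2 : ℝ)⁻¹ (x.1.2 + y.1.2), Lp.coeFn_add x.1.2 y.1.2] with a k1 k2
      refine k1.trans ?_
      rw [Pi.smul_apply, k2, Pi.add_apply]
  have hcoer (z : sobolevClosure p Ω U) :
      min 1 (c ^ (p / 2)) * ‖z‖ ^ p ≤ J z + ‖sobolevEmbedding p Ω U z‖ ^ p := by
    have k1 := hB.norm_rpow_le_energy hp0 z.1.2
    have k0 := hB.energy_nonneg (p := p) z.1.2
    have n1 : 0 ≤ ‖z.1.1‖ ^ p := by positivity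
    have n2 : 0 ≤ ‖z.1.2‖ ^ p := by positivity
    change _ ≤ energy (volume.restrict Ω) B p z.1.2 + ‖z.1.1‖ ^ p
    -- The product carries the sup norm: either `‖u‖` is the larger, with constant 1, or `‖∇u‖` is,
    -- with the ellipticity constant.
    have e : ‖z‖ = max ‖z.1.1‖ ‖z.1.2‖ := rfl
    rw [e]
    rcases max_choice ‖z.1.1‖ ‖z.1.2‖ with h | h <;> rw [h]
    · nlinarith [min_le_left 1 (c ^ (p / 2))]
    · nlinarith [min_le_right 1 (c ^ (p / 2))]
  obtain ⟨z, h1, h2⟩ := exists_minimizer_of_clarkson (sobolevEmbedding p Ω U) hcomp hJc hp0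
    (lt_min one_pos (Real.rpow_pos_of_pos hc _)) (fun z => hB.energy_nonneg _) hom hclark hcoer
    (by
      obtain ⟨z, hz, h⟩ := hne
      exact ⟨⟨z, hz⟩, h⟩)
  exact ⟨z.1, z.2, h1, fun w hw => h2 ⟨w, hw⟩⟩

end Eigenvalue

/-! ### The splitting `ℝ^n = ℝ × ℝ^{n-1}` and the geometry of the cylinder. -/

section Splitting

variable {d : ℕ}

/-- The point `(s, y)` of `ℝ × ℝ^{n-1}`. -/
def pair (s : ℝ) (y : Eu d) : Eu (d + 1) := WithLp.toLp 2 (Fin.cons s fun j => y j)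

@[simp] theorem pair_apply_zero (s : ℝ) (y : Eu d) : pair s y 0 = s := rfl

@[simp] theorem pair_apply_succ (s : ℝ) (y : Eu d) (j : Fin d) : pair s y j.succ = y j := rfl

@[simp] theorem X2_apply (x : Eu (d + 1)) (j : Fin d) : X2 x j = x j.succ := rfl

@[simp] theorem X2_pair (s : ℝ) (y : Eu d) : X2 (pair s y) = y := by ext j; simp

theorem pair_X2 (x : Eu (d + 1)) : pair (x 0) (X2 x) = x := by
  ext i
  refine Fin.cases ?_ (fun j => ?_) i <;> simp

/-- The projection `x ↦ X₂` as a continuous linear map. -/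
def X2L : Eu (d + 1) →L[ℝ] Eu d :=
  LinearMap.toContinuousLinearMap
    { toFun := X2
      map_add' := fun x y => by ext j; simp
      map_smul' := fun t x => by ext j; simp }

theorem X2L_apply (x : Eu (d + 1)) : X2L x = X2 x := rfl

theorem continuous_X2 : Continuous (X2 : Eu (d + 1) → Eu d) := X2L.continuous

/-- The injection `(s, y) ↦ (s, y)` of `ℝ × ℝ^{n-1}` into `ℝ^n` as a continuous linear map. -/
def pairL : ℝ × Eu d →L[ℝ] Eu (d + 1) :=
  LinearMap.toContinuousLinearMap
    { toFun := fun z => pair z.1 z.2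
      map_add' := fun x y => by
        ext i
        refine Fin.cases ?_ (fun j => ?_) i <;> simp
      map_smul' := fun t x => by
        ext i
        refine Fin.cases ?_ (fun j => ?_) i <;> simp }

theorem pairL_apply (z : ℝ × Eu d) : pairL z = pair z.1 z.2 := rfl

theorem continuous_pair : Continuous fun z : ℝ × Eu d => pair z.1 z.2 := pairL.continuous

theorem norm_pair_sq (s : ℝ) (y : Eu d) : ‖pair s y‖ ^ 2 = s ^ 2 + ‖y‖ ^ 2 := by
  simp [EuclideanSpace.norm_sq_eq, Fin.sum_univ_succ]

/-- The measurable equivalence `ℝ^n ≃ ℝ × ℝ^{n-1}`. -/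
def splitEquiv : Eu (d + 1) ≃ᵐ ℝ × Eu d where
  toFun x := (x 0, X2 x)
  invFun z := pair z.1 z.2
  left_inv x := pair_X2 x
  right_inv z := by simp
  measurable_toFun := by
    have h : Continuous fun x : Eu (d + 1) => (x 0, X2 x) :=
      (by fun_prop : Continuous fun x : Eu (d + 1) => x 0).prodMk continuous_X2
    exact h.measurable
  measurable_invFun := continuous_pair.measurable

theorem measurePreserving_splitEquiv :
    MeasurePreserving (splitEquiv (d := d)) volume (volume.prod volume) := by
  have h1 := PiLp.volume_preserving_ofLp (Fin (d + 1))
  have h2 := volume_preserving_piFinSuccAbove (fun _ : Fin (d + 1) => ℝ) 0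
  have h3 := (MeasurePreserving.id (volume : Measure ℝ)).prod (PiLp.volume_preserving_toLp (Fin d))
  exact h3.comp (h2.comp h1)

theorem cylinder_eq_preimage (ω : Set (Eu d)) (ℓ : ℝ) :
    cylinder ω ℓ = splitEquiv ⁻¹' (Ioo (-ℓ) ℓ ×ˢ ω) := rfl

theorem measurePreserving_splitEquiv_cylinder (ω : Set (Eu d)) (ℓ : ℝ) :
    MeasurePreserving (splitEquiv (d := d)) (volume.restrict (cylinder ω ℓ))
      ((volume.restrict (Ioo (-ℓ) ℓ)).prod (volume.restrict ω)) := by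
  rw [Measure.prod_restrict, cylinder_eq_preimage]
  exact measurePreserving_splitEquiv.restrict_preimage_emb splitEquiv.measurableEmbedding _

theorem quasiMeasurePreserving_X2 (ω : Set (Eu d)) (ℓ : ℝ) :
    Measure.QuasiMeasurePreserving X2 (volume.restrict (cylinder ω ℓ)) (volume.restrict ω) :=
  Measure.quasiMeasurePreserving_snd.comp
    (measurePreserving_splitEquiv_cylinder ω ℓ).quasiMeasurePreserving

theorem isOpen_strip {ω : Set (Eu d)} (hω : IsOpen ω) : IsOpen (strip ω) :=
  hω.preimage continuous_X2

theorem IsEllipticField.comp_quasiMeasurePreserving {α β : Type*} [MeasurableSpace α]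
    [MeasurableSpace β] {μ : Measure α} {ν : Measure β} {N : ℕ} {M c : ℝ}
    {B : α → Matrix (Fin N) (Fin N) ℝ} (hB : IsEllipticField μ M c B) {f : β → α}
    (hf : Measure.QuasiMeasurePreserving f ν μ) : IsEllipticField ν M c fun x => B (f x) :=
  ⟨hB.pos, hB.nonneg, fun i j => (hB.measurable i j).comp_quasiMeasurePreserving hf,
    hf.ae hB.ae_elliptic⟩

theorem IsAdmissible.exists_isEllipticField {N : ℕ} {ω : Set (Eu d)}
    {A : Eu d → Matrix (Fin N) (Fin N) ℝ} (hA : IsAdmissible ω A) :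
    ∃ M c, IsEllipticField (volume.restrict ω) M c A := by
  obtain ⟨M, hM⟩ := hA.bounded
  obtain ⟨c, hc, hAc⟩ := hA.elliptic
  refine ⟨max M 0, c, hc, le_max_right _ _, hA.measurable, ?_⟩
  filter_upwards [hA.symm, hM, hAc] with y h1 h2 h3
  exact ⟨h1, fun ξ => (h2 ξ).trans
    (mul_le_mul_of_nonneg_right (le_max_left _ _) (norm_nonneg _)), h3⟩

/-- The compactness theorem wants a convex `Q`, while `ω` is arbitrary. A slab over a ball
containing `ω` works: the ends of the cylinder lie on the boundary of `Q`, where no vanishing is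
required, and the lateral condition is carried by the strip. -/
theorem exists_cylinder_eq_inter_strip {ω : Set (Eu d)} (hω : Bornology.IsBounded ω) (ℓ : ℝ) :
    ∃ Q : Set (Eu (d + 1)), Convex ℝ Q ∧ MeasurableSet Q ∧ Bornology.IsBounded Q ∧
      cylinder ω ℓ = Q ∩ strip ω := by
  obtain ⟨R, hR⟩ := hω.exists_norm_le
  set L : Eu (d + 1) →L[ℝ] ℝ := EuclideanSpace.proj 0
  refine ⟨L ⁻¹' Ioo (-ℓ) ℓ ∩ X2L ⁻¹' Metric.closedBall 0 R, ?_, ?_, ?_, ?_⟩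
  · exact ((convex_Ioo _ _).linear_preimage L.toLinearMap).inter
      ((convex_closedBall _ _).linear_preimage X2L.toLinearMap)
  · exact (L.continuous.measurable measurableSet_Ioo).inter
      (X2L.continuous.measurable Metric.isClosed_closedBall.measurableSet)
  · refine isBounded_iff_forall_norm_le.2 ⟨|ℓ| + |R|, fun x hx => ?_⟩
    have h1 : |x 0| ≤ |ℓ| := abs_le_abs (by have := hx.1.2; exact this.le)
      (by have h : -ℓ < x 0 := hx.1.1; linarith)
    have h2 : ‖X2 x‖ ≤ |R| := (mem_closedBall_zero_iff.1 hx.2).trans (le_abs_self R)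
    rw [← pair_X2 x, ← sq_le_sq₀ (norm_nonneg _) (by positivity), norm_pair_sq]
    have := sq_abs (x 0)
    nlinarith [abs_nonneg (x 0), norm_nonneg (X2 x)]
  · ext x
    refine ⟨fun hx => ⟨⟨hx.1, ?_⟩, hx.2⟩, fun hx => ⟨hx.1.1, hx.2⟩⟩
    exact mem_closedBall_zero_iff.2 (hR _ hx.2)

end Splitting

/-! ### The smallest eigenvalue of the mixed problem. -/

section FirstEigenvalue

variable {d : ℕ} {p : ℝ} {ω : Set (Eu d)} {A : Eu d → Matrix (Fin (d + 1)) (Fin (d + 1)) ℝ} {ℓ : ℝ}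

theorem isFiniteMeasure_cylinder (hω : Bornology.IsBounded ω) (ℓ : ℝ) :
    IsFiniteMeasure (volume.restrict (cylinder ω ℓ)) := by
  obtain ⟨Q, -, -, hQ, h⟩ := exists_cylinder_eq_inter_strip hω ℓ
  refine ⟨?_⟩
  rw [Measure.restrict_apply_univ, h]
  exact (hQ.subset inter_subset_left).measure_lt_top

theorem IsTestFunction.integral_abs_rpow_pos {N : ℕ} {U Ω : Set (Eu N)} {φ : Eu N → ℝ} {p : ℝ}
    (hp : 0 < p) (hφ : IsTestFunction U φ) (hΩ : IsOpen Ω) {x₀ : Eu N} (hx₀ : x₀ ∈ Ω)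
    (hne : φ x₀ ≠ 0) : 0 < ∫ x in Ω, |φ x| ^ p := by
  have hi : Integrable (fun x => |φ x| ^ p) (volume.restrict Ω) := by
    have h := (hφ.memLp (ENNReal.ofReal p) Ω).integrable_norm_rpow (by simpa using hp) (by simp)
    rwa [ENNReal.toReal_ofReal hp.le] at h
  have hn : ∀ x, 0 ≤ |φ x| ^ p := fun x => by positivity
  rw [setIntegral_pos_iff_support_of_nonneg_ae (Eventually.of_forall hn) hi]
  refine lt_of_lt_of_le ?_ (measure_mono (s := {x | φ x ≠ 0} ∩ Ω) ?_)
  · exact ((isOpen_ne_fun hφ.continuous continuous_const).inter hΩ).measure_pos _ ⟨x₀, hne, hx₀⟩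
  · rintro x ⟨hx, hxΩ⟩
    exact ⟨(Real.rpow_pos_of_pos (abs_pos.2 hx) p).ne', hxΩ⟩

/-- Existence of the smallest eigenvalue and its variational characterization. -/
theorem exists_isLeast_isMixedEigenvalue [Fact (1 ≤ ENNReal.ofReal p)] (hp : 2 ≤ p)
    (hω : IsOpen ω) (hωb : Bornology.IsBounded ω) (hωne : ω.Nonempty) (hA : IsAdmissible ω A)
    (hℓ : 0 < ℓ) :
    ∃ lam, IsLeast {lam : ℝ | IsMixedEigenvalue p ω A ℓ lam} lam ∧
      (∀ w ∈ sobolevClosure p (cylinder ω ℓ) (strip ω), lam * ‖w.1‖ ^ p ≤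
        energy (volume.restrict (cylinder ω ℓ)) (fun x => A (X2 x)) p w.2) ∧
      ∃ z ∈ sobolevClosure p (cylinder ω ℓ) (strip ω), ‖z.1‖ = 1 ∧
        energy (volume.restrict (cylinder ω ℓ)) (fun x => A (X2 x)) p z.2 = lam := by
  have hp0 : 0 < p := by linarith
  have hfin := isFiniteMeasure_cylinder hωb ℓ
  obtain ⟨M, c, hE⟩ := hA.exists_isEllipticField
  have hB := hE.comp_quasiMeasurePreserving (quasiMeasurePreserving_X2 ω ℓ)
  have hcomp : IsCompactOperator (sobolevEmbedding p (cylinder ω ℓ) (strip ω)) := by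
    obtain ⟨Q, h1, h2, h3, h4⟩ := exists_cylinder_eq_inter_strip hωb ℓ
    exact isCompactOperator_sobolevEmbedding (by linarith) h1 h2 h3 (isOpen_strip hω).measurableSet h4
  have hne : ∃ z ∈ sobolevClosure p (cylinder ω ℓ) (strip ω), z.1 ≠ 0 := by
    obtain ⟨y, hy⟩ := hωne
    have hys : pair 0 y ∈ strip ω := by simpa [strip] using hy
    obtain ⟨φ, hφ, hφ1⟩ := IsTestFunction.exists_pos (isOpen_strip hω) hys
    refine ⟨_, hφ.mem_sobolevClosure, fun h => ?_⟩
    have hopen : IsOpen (cylinder ω ℓ) :=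
      (isOpen_Ioo.preimage (by fun_prop : Continuous fun x : Eu (d + 1) => x 0)).inter
        (isOpen_strip hω)
    have hpos := hφ.integral_abs_rpow_pos hp0 hopen (x₀ := pair 0 y) ⟨by simpa using hℓ, hys⟩
      (by simp [hφ1])
    have hz := (hφ.memLp (ENNReal.ofReal p) (cylinder ω ℓ)).coeFn_toLp
    dsimp only at h
    rw [h] at hz
    refine hpos.ne' (integral_eq_zero_of_ae ?_)
    filter_upwards [hz, Lp.coeFn_zero ℝ (ENNReal.ofReal p) (volume.restrict (cylinder ω ℓ))]
      with x h1 h2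
    rw [← h1, h2]
    simp [hp0.ne']
  obtain ⟨z, hz, hz1, hmin⟩ := exists_minimizer_energy hp hB hcomp hne
  refine ⟨_, ⟨⟨z.1, z.2, memW1pClosure_of_mem_sobolevClosure hz, ?_, ?_⟩, ?_⟩, hmin, z, hz, hz1, rfl⟩
  · intro h
    have : z.1 = 0 := (Lp.eq_zero_iff_ae_eq_zero).2 h
    simp [this] at hz1
  · intro v h hv
    have key := eulerLagrange_of_minimizer hp hB hz hv.mem_sobolevClosure hmin
      (by rw [hz1, Real.one_rpow, mul_one])
    refine Eq.trans (Eq.trans ?_ key) ?_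
    · refine integral_congr_ae ?_
      filter_upwards [hv.1.2.1.coeFn_toLp] with x hx
      simp only [hx]
    · congr 1
      refine integral_congr_ae ?_
      filter_upwards [hv.1.1.coeFn_toLp] with x hx
      simp only [hx]
  -- Testing the equation with the eigenfunction itself shows that `mu` is its Rayleigh quotient,
  -- which is at least the minimum.
  · rintro mu ⟨u, g, hu, hu0, heq⟩
    have h1 := hmin _ hu.mem_sobolevClosure
    have h2 := heq u g hu
    have e1 : ∫ x in cylinder ω ℓ,
        |form (A (X2 x)) (g x) (g x)| ^ ((p - 2) / 2) * form (A (X2 x)) (g x) (g x) =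
        energy (volume.restrict (cylinder ω ℓ)) (fun x => A (X2 x)) p (hu.1.2.1.toLp g) := by
      rw [energy_congr hu.1.2.1.coeFn_toLp]
      refine integral_congr_ae ?_
      filter_upwards [hB.ae_elliptic] with x hx
      have h0 := hx.form_self_nonneg hB.pos.le (g x)
      rw [abs_of_nonneg h0]
      rcases h0.eq_or_lt with h | h
      · rw [← h, mul_zero, Real.zero_rpow (by linarith)]
      · rw [show (p - 2) / 2 = p / 2 - 1 by ring, Real.rpow_sub_one h.ne', div_mul_cancel₀ _ h.ne']
    have e2 : ∫ x in cylinder ω ℓ, |u x| ^ (p - 2) * u x * u x = ‖hu.1.1.toLp u‖ ^ p := by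
      rw [← integral_abs_rpow_eq_norm hp0]
      refine integral_congr_ae ?_
      filter_upwards [hu.1.1.coeFn_toLp] with x hx
      rw [hx, Real.norm_eq_abs, mul_assoc, ← abs_mul_abs_self]
      rcases (abs_nonneg (u x)).eq_or_lt with h | h
      · rw [← h, mul_zero, mul_zero, Real.zero_rpow hp0.ne']
      · rw [Real.rpow_sub h, Real.rpow_two, div_mul_eq_mul_div, pow_two, mul_div_cancel_right₀]
        positivity
    rw [e1, e2] at h2
    have hpos : 0 < ‖hu.1.1.toLp u‖ ^ p := by
      refine Real.rpow_pos_of_pos (norm_pos_iff.2 fun h => hu0 ?_) p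
      have := hu.1.1.coeFn_toLp
      rw [h] at this
      exact this.symm.trans (Lp.coeFn_zero _ _ _)
    refine le_of_mul_le_mul_right (h1.trans (le_of_eq ?_)) hpos
    exact h2

end FirstEigenvalue

/-! ### Elimination of the first component and the lower bound by `Λ`. -/

section Reduction

variable {d : ℕ}

theorem inner_pair (s : ℝ) (y : Eu d) (v : Eu (d + 1)) :
    inner ℝ (pair s y) v = s * v 0 + inner ℝ y (X2 v) := by
  simp [PiLp.inner_apply, Fin.sum_univ_succ, mul_comm]

theorem form_pair {B : Matrix (Fin (d + 1)) (Fin (d + 1)) ℝ} (hB : B.IsSymm) (s : ℝ) (y : Eu d) :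
    form B (pair s y) (pair s y) =
      a11 B * s ^ 2 + 2 * s * inner ℝ (A12 B) y + form (A22 B) y y := by
  have hs : ∀ j : Fin d, B j.succ 0 = B 0 j.succ := fun j => hB.apply 0 j.succ
  simp only [form_eq_sum, Fin.sum_univ_succ, pair_apply_zero, pair_apply_succ, a11, A12, A22,
    PiLp.inner_apply, Matrix.submatrix_apply, RCLike.inner_apply, conj_trivial, hs,
    Finset.sum_add_distrib, Finset.mul_sum]
  have h1 : ∑ i : Fin d, 2 * s * (y i * B 0 i.succ) =
      ∑ i : Fin d, B 0 i.succ * y i * s + ∑ i : Fin d, B 0 i.succ * s * y i := by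
    rw [← Finset.sum_add_distrib]
    exact Finset.sum_congr rfl fun i _ => by ring
  rw [h1]
  ring

theorem form_pair_one_zero {B : Matrix (Fin (d + 1)) (Fin (d + 1)) ℝ} (hB : B.IsSymm) (y : Eu d) :
    form B (pair 1 0) (pair 0 y) = inner ℝ (A12 B) y := by
  have hs : ∀ j : Fin d, B j.succ 0 = B 0 j.succ := fun j => hB.apply 0 j.succ
  simp [form_eq_sum, Fin.sum_univ_succ, A12, PiLp.inner_apply, hs, mul_comm]

/-- The vector `(s, η)` which minimizes `B ξ · ξ` among those with `X₂`-component `η`. -/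
def lift (B : Matrix (Fin (d + 1)) (Fin (d + 1)) ℝ) (η : Eu d) : Eu (d + 1) :=
  pair (-(inner ℝ (A12 B) η / a11 B)) η

namespace IsEllipticMatrix

variable {M c : ℝ} {B : Matrix (Fin (d + 1)) (Fin (d + 1)) ℝ}

theorem le_a11 (h : IsEllipticMatrix M c B) : c ≤ a11 B := by
  have h1 := h.elliptic (pair 1 0)
  rw [norm_pair_sq, form_pair h.symm] at h1
  simpa [form] using h1

theorem form_lift (h : IsEllipticMatrix M c B) (hc : 0 < c) (η : Eu d) :
    form B (lift B η) (lift B η) =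
      form (A22 B) η η - |(inner ℝ (A12 B) η : ℝ)| ^ 2 / a11 B := by
  have ha : a11 B ≠ 0 := (hc.trans_le h.le_a11).ne'
  rw [lift, form_pair h.symm, sq_abs]
  field_simp
  ring

/-- The difference of the two sides is the complete square `a₁₁(ξ₁ + A₁₂·ξ'/a₁₁)²`. -/
theorem form_lift_le (h : IsEllipticMatrix M c B) (hc : 0 < c) (ξ : Eu (d + 1)) :
    form B (lift B (X2 ξ)) (lift B (X2 ξ)) ≤ form B ξ ξ := by
  have ha : 0 < a11 B := hc.trans_le h.le_a11
  rw [h.form_lift hc, sq_abs]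
  conv_rhs => rw [← pair_X2 ξ, form_pair h.symm]
  have h1 : 0 ≤ a11 B * (ξ 0 + inner ℝ (A12 B) (X2 ξ) / a11 B) ^ 2 := by positivity
  have h2 : a11 B * (ξ 0 + inner ℝ (A12 B) (X2 ξ) / a11 B) ^ 2 = a11 B * ξ 0 ^ 2 +
      2 * ξ 0 * inner ℝ (A12 B) (X2 ξ) + inner ℝ (A12 B) (X2 ξ) ^ 2 / a11 B := by
    field_simp
    ring
  linarith

/-- The numerator is `B e₁·(0, η)`, at most `M ‖η‖`, and the denominator is at least `c`. Hence the
optimal first component is in `L^p` whenever `∇u` is. -/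
theorem abs_inner_A12_div_le (h : IsEllipticMatrix M c B) (hc : 0 < c) (η : Eu d) :
    |(inner ℝ (A12 B) η : ℝ) / a11 B| ≤ M / c * ‖η‖ := by
  have n1 : ‖(pair 1 0 : Eu (d + 1))‖ = 1 := by
    rw [← sq_eq_sq₀ (norm_nonneg _) zero_le_one, norm_pair_sq]; simp
  have n2 : ‖(pair 0 η : Eu (d + 1))‖ = ‖η‖ := by
    rw [← sq_eq_sq₀ (norm_nonneg _) (norm_nonneg _), norm_pair_sq]; simp
  have h1 := h.abs_form_le (pair 1 0) (pair 0 η)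
  rw [form_pair_one_zero h.symm, n1, n2, mul_one] at h1
  rw [abs_div, abs_of_pos (hc.trans_le h.le_a11), div_mul_eq_mul_div]
  exact div_le_div₀ ((abs_nonneg _).trans h1) h1 hc h.le_a11

end IsEllipticMatrix

variable {M c p : ℝ} {ω : Set (Eu d)} {A : Eu d → Matrix (Fin (d + 1)) (Fin (d + 1)) ℝ}

theorem IsEllipticField.memLp_inner_A12_div {α : Type*} [MeasurableSpace α] {μ : Measure α}
    {A : α → Matrix (Fin (d + 1)) (Fin (d + 1)) ℝ} (hA : IsEllipticField μ M c A) {q : ENNReal}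
    {g : α → Eu d} (hg : MemLp g q μ) :
    MemLp (fun y => -((inner ℝ (A12 (A y)) (g y) : ℝ) / a11 (A y))) q μ := by
  refine (hg.of_le_mul (c := M / c) ?_ ?_)
  -- Almost everywhere `A` is symmetric and the inner product is a value of `form`, whose
  -- measurability is already known.
  · refine ((AEStronglyMeasurable.congr (f := fun y => form (A y) (pair 1 0) (pair 0 (g y)) /
      a11 (A y)) ?_ ?_)).neg
    · refine AEMeasurable.aestronglyMeasurable (AEMeasurable.div
        (aestronglyMeasurable_form hA.measurable aestronglyMeasurable_const ?_).aemeasurable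
        (hA.measurable 0 0))
      exact (continuous_pair.comp (continuous_const.prodMk continuous_id)).comp_aestronglyMeasurable
        hg.1
    · filter_upwards [hA.ae_elliptic] with y hy
      rw [form_pair_one_zero hy.symm]
  · filter_upwards [hA.ae_elliptic] with y hy
    rw [norm_neg]
    exact hy.abs_inner_A12_div_le hA.pos (g y)

theorem memLp_pair {α : Type*} [MeasurableSpace α] {μ : Measure α} {q : ENNReal} {a : α → ℝ}
    {g : α → Eu d} (ha : MemLp a q μ) (hg : MemLp g q μ) : MemLp (fun y => pair (a y) (g y)) q μ := by
  refine (ha.norm.add hg.norm).mono (continuous_pair.comp_aestronglyMeasurable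
    (ha.1.prodMk hg.1)) (Eventually.of_forall fun y => ?_)
  rw [Pi.add_apply, Real.norm_of_nonneg (by positivity), ← sq_le_sq₀ (norm_nonneg _) (by positivity),
    norm_pair_sq]
  have := norm_nonneg (a y)
  have := norm_nonneg (g y)
  have : ‖a y‖ ^ 2 = a y ^ 2 := by rw [Real.norm_eq_abs, sq_abs]
  nlinarith

theorem IsEllipticField.integral_reduced_eq_energy {α : Type*} [MeasurableSpace α] {μ : Measure α}
    {A : α → Matrix (Fin (d + 1)) (Fin (d + 1)) ℝ} (hA : IsEllipticField μ M c A) (g : α → Eu d) :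
    ∫ y, (form (A22 (A y)) (g y) (g y)
      - |(inner ℝ (A12 (A y)) (g y) : ℝ)| ^ 2 / a11 (A y)) ^ (p / 2) ∂μ =
    energy μ A p fun y => lift (A y) (g y) := by
  refine integral_congr_ae ?_
  filter_upwards [hA.ae_elliptic] with y hy
  rw [hy.form_lift hA.pos]

theorem lift_smul (B : Matrix (Fin (d + 1)) (Fin (d + 1)) ℝ) (t : ℝ) (η : Eu d) :
    lift B (t • η) = t • lift B η := by
  ext i
  refine Fin.cases ?_ (fun j => ?_) i
  · simp [lift, inner_smul_right]; ring
  · simp [lift]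

/-- The admissible energies in the definition of `limitValue`. -/
theorem limitValue_eq (hA : IsEllipticField (volume.restrict ω) M c A) :
    limitValue p ω A = sInf {E : ℝ | ∃ (u : Eu d → ℝ) (g : Eu d → Eu d), MemW1pZero p ω u g ∧
      ∫ y in ω, |u y| ^ p = 1 ∧ E = energy (volume.restrict ω) A p fun y => lift (A y) (g y)} := by
  unfold limitValue
  simp only [hA.integral_reduced_eq_energy]

theorem limitValue_mul_le (hp : 0 < p) (hA : IsEllipticField (volume.restrict ω) M c A)
    {φ : Eu d → ℝ} (hφ : IsTestFunction ω φ) :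
    limitValue p ω A * ∫ y in ω, |φ y| ^ p ≤
      energy (volume.restrict ω) A p fun y => lift (A y) (∇ φ y) := by
  set m := ∫ y in ω, |φ y| ^ p with hm
  have hm0 : 0 ≤ m := integral_nonneg fun y => by positivity
  rcases hm0.eq_or_lt with h | h
  · rw [← h, mul_zero]
    exact hA.energy_nonneg _
  -- This scaling gives `t • φ` unit mass; both sides are `p`-homogeneous.
  set t := m ^ (-p⁻¹) with ht
  have ht0 : 0 < t := Real.rpow_pos_of_pos h _
  have htp : t ^ p = m⁻¹ := by
    rw [ht, ← Real.rpow_mul h.le, neg_mul, inv_mul_cancel₀ hp.ne', Real.rpow_neg_one]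
  have hle : limitValue p ω A ≤
      energy (volume.restrict ω) A p fun y => lift (A y) (∇ (t • φ) y) := by
    rw [limitValue_eq hA]
    refine csInf_le ⟨0, ?_⟩ ⟨t • φ, ∇ (t • φ), (hφ.smul t).memW1pClosure p ω, ?_, rfl⟩
    · rintro E ⟨u, g, -, -, rfl⟩
      exact hA.energy_nonneg _
    · simp only [Pi.smul_apply, smul_eq_mul, abs_mul, abs_of_pos ht0]
      simp only [Real.mul_rpow ht0.le (abs_nonneg _)]
      rw [integral_const_mul, ← hm, htp, inv_mul_cancel₀ h.ne']
  rw [hφ.gradient_smul] at hle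
  simp only [Pi.smul_apply, lift_smul] at hle
  rw [hA.energy_smul, abs_of_pos ht0, htp, inv_mul_eq_div, le_div_iff₀ h] at hle
  exact hle

theorem setIntegral_cylinder {F : Eu (d + 1) → ℝ} {ℓ : ℝ}
    (hF : Integrable F (volume.restrict (cylinder ω ℓ))) :
    ∫ x in cylinder ω ℓ, F x = ∫ s in Ioo (-ℓ) ℓ, ∫ y in ω, F (pair s y) := by
  have hE := measurePreserving_splitEquiv_cylinder ω ℓ
  have h1 := hE.integral_comp splitEquiv.measurableEmbedding fun z => F (splitEquiv.symm z)
  have h2 := (hE.integrable_comp_emb splitEquiv.measurableEmbedding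
    (g := fun z => F (splitEquiv.symm z))).1 (by simpa [Function.comp_def] using hF)
  simp only [MeasurableEquiv.symm_apply_apply] at h1
  rw [h1, integral_prod _ h2]
  rfl

theorem integrable_setIntegral_slice {F : Eu (d + 1) → ℝ} {ℓ : ℝ}
    (hF : Integrable F (volume.restrict (cylinder ω ℓ))) :
    Integrable (fun s => ∫ y in ω, F (pair s y)) (volume.restrict (Ioo (-ℓ) ℓ)) := by
  have hE := measurePreserving_splitEquiv_cylinder ω ℓ
  have h2 := (hE.integrable_comp_emb splitEquiv.measurableEmbedding
    (g := fun z => F (splitEquiv.symm z))).1 (by simpa [Function.comp_def] using hF)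
  exact h2.integral_prod_left

theorem hasFDerivAt_pair (s : ℝ) (y : Eu d) :
    HasFDerivAt (fun y : Eu d => pair s y) (pairL.comp (ContinuousLinearMap.inr ℝ ℝ (Eu d))) y :=
  pairL.hasFDerivAt.comp y (hasFDerivAt_prodMk_right s y)

/-- The projection of the compact support of `φ` to `ℝ^{n-1}` is compact and lies in `ω`, and it
contains the support of every slice. -/
theorem IsTestFunction.slice {φ : Eu (d + 1) → ℝ} (hφ : IsTestFunction (strip ω) φ) (s : ℝ) :
    IsTestFunction ω fun y => φ (pair s y) := by
  have hK : IsCompact (X2 '' tsupport φ) := hφ.2.1.isCompact.image continuous_X2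
  have hsub : tsupport (fun y => φ (pair s y)) ⊆ X2 '' tsupport φ := by
    refine closure_minimal (fun y hy => ⟨pair s y, subset_tsupport φ hy, X2_pair s y⟩) hK.isClosed
  refine ⟨?_, hK.of_isClosed_subset (isClosed_tsupport _) hsub, hsub.trans ?_⟩
  · exact hφ.1.comp (pairL.contDiff.comp (contDiff_const.prodMk contDiff_id))
  · rintro _ ⟨x, hx, rfl⟩
    exact hφ.2.2 hx

theorem IsTestFunction.gradient_slice {φ : Eu (d + 1) → ℝ} (hφ : IsTestFunction (strip ω) φ)
    (s : ℝ) (y : Eu d) : ∇ (fun y => φ (pair s y)) y = X2 (∇ φ (pair s y)) := by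
  refine HasGradientAt.gradient ?_
  rw [hasGradientAt_iff_hasFDerivAt]
  refine ((hφ.differentiable (pair s y)).hasFDerivAt.comp y (hasFDerivAt_pair s y)).congr_fderiv ?_
  ext v
  have h := inner_pair 0 v (∇ φ (pair s y))
  rw [zero_mul, zero_add, real_inner_comm, inner_gradient_left] at h
  simpa [pairL_apply, real_inner_comm] using h

/-- By Fubini it suffices to compare on each slice, where the slice competes for `Λ` and
`form_lift_le` discards the `x₁`-derivative. No smallness of `ℓ` enters. -/
theorem limitValue_mul_le_energy_cylinder (hp : 0 < p) (hωb : Bornology.IsBounded ω)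
    (hA : IsEllipticField (volume.restrict ω) M c A) {φ : Eu (d + 1) → ℝ}
    (hφ : IsTestFunction (strip ω) φ) (ℓ : ℝ) :
    limitValue p ω A * ∫ x in cylinder ω ℓ, |φ x| ^ p ≤
      energy (volume.restrict (cylinder ω ℓ)) (fun x => A (X2 x)) p (∇ φ) := by
  have hfin : IsFiniteMeasure (volume.restrict ω) := ⟨by simpa using hωb.measure_lt_top⟩
  have hB := hA.comp_quasiMeasurePreserving (quasiMeasurePreserving_X2 ω ℓ)
  have i1 : Integrable (fun x => |φ x| ^ p) (volume.restrict (cylinder ω ℓ)) := by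
    have h := (hφ.memLp (ENNReal.ofReal p) (cylinder ω ℓ)).integrable_norm_rpow (by simpa using hp)
      (by simp)
    rwa [ENNReal.toReal_ofReal hp.le] at h
  have i2 := hB.integrable_energy hp (hφ.memLp_gradient (ENNReal.ofReal p) (cylinder ω ℓ))
  rw [energy, setIntegral_cylinder i1, setIntegral_cylinder i2, ← integral_const_mul]
  refine integral_mono ((integrable_setIntegral_slice i1).const_mul _)
    (integrable_setIntegral_slice i2) fun s => ?_
  have hs := hφ.slice s
  refine (limitValue_mul_le hp hA hs).trans ?_
  have hc : Continuous fun y : Eu d => pair s y :=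
    continuous_pair.comp (continuous_const.prodMk continuous_id)
  have m1 : MemLp (fun y => ∇ φ (pair s y)) (ENNReal.ofReal p) (volume.restrict ω) := by
    obtain ⟨K, hK⟩ := hφ.hasCompactSupport_gradient.exists_bound_of_continuous hφ.continuous_gradient
    exact MemLp.of_bound (hφ.continuous_gradient.comp hc).aestronglyMeasurable K
      (Eventually.of_forall fun y => hK _)
  have m2 : MemLp (fun y => lift (A y) (∇ (fun y => φ (pair s y)) y)) (ENNReal.ofReal p)
      (volume.restrict ω) :=
    memLp_pair (hA.memLp_inner_A12_div (hs.memLp_gradient _ _)) (hs.memLp_gradient _ _)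
  have i3 := hA.integrable_energy hp m1
  simp only [X2_pair]
  refine integral_mono_ae (hA.integrable_energy hp m2) i3 ?_
  filter_upwards [hA.ae_elliptic] with y hy
  rw [hφ.gradient_slice s y]
  exact Real.rpow_le_rpow (hy.form_self_nonneg hA.pos.le _) (hy.form_lift_le hA.pos _)
    (by positivity)

theorem limitValue_mul_le_of_mem_sobolevClosure [Fact (1 ≤ ENNReal.ofReal p)] (hp : 1 ≤ p)
    (hωb : Bornology.IsBounded ω) (hA : IsEllipticField (volume.restrict ω) M c A) (ℓ : ℝ)
    {z : Lp ℝ (ENNReal.ofReal p) (volume.restrict (cylinder ω ℓ)) ×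
      Lp (Eu (d + 1)) (ENNReal.ofReal p) (volume.restrict (cylinder ω ℓ))}
    (hz : z ∈ sobolevClosure p (cylinder ω ℓ) (strip ω)) :
    limitValue p ω A * ‖z.1‖ ^ p ≤
      energy (volume.restrict (cylinder ω ℓ)) (fun x => A (X2 x)) p z.2 := by
  have hp0 : 0 < p := by linarith
  have hB := hA.comp_quasiMeasurePreserving (quasiMeasurePreserving_X2 ω ℓ)
  have hclosed : IsClosed {z : Lp ℝ (ENNReal.ofReal p) (volume.restrict (cylinder ω ℓ)) ×
      Lp (Eu (d + 1)) (ENNReal.ofReal p) (volume.restrict (cylinder ω ℓ)) |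
      limitValue p ω A * ‖z.1‖ ^ p ≤
        energy (volume.restrict (cylinder ω ℓ)) (fun x => A (X2 x)) p z.2} :=
    isClosed_le (continuous_const.mul (continuous_fst.norm.rpow_const fun _ => Or.inr hp0.le))
      ((hB.continuous_energy hp).comp continuous_snd)
  have hsub : (testSubmodule p (cylinder ω ℓ) (strip ω) : Set _) ⊆
      {z : Lp ℝ (ENNReal.ofReal p) (volume.restrict (cylinder ω ℓ)) ×
      Lp (Eu (d + 1)) (ENNReal.ofReal p) (volume.restrict (cylinder ω ℓ)) |
      limitValue p ω A * ‖z.1‖ ^ p ≤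
        energy (volume.restrict (cylinder ω ℓ)) (fun x => A (X2 x)) p z.2} := by
    rintro w ⟨φ, hφ, h1, h2⟩
    rw [mem_ofPred_eq, energy_congr h2, ← integral_abs_rpow_eq_norm hp0]
    refine le_trans (le_of_eq ?_) (limitValue_mul_le_energy_cylinder hp0 hωb hA hφ ℓ)
    congr 1
    refine integral_congr_ae ?_
    filter_upwards [h1] with x hx
    rw [hx, Real.norm_eq_abs]
  exact closure_minimal hsub hclosed hz

end Reduction

/-! ### Density of test functions in `L^p(ω)`. -/

section Density

variable {N : ℕ} {ω : Set (Eu N)}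

/-- Smooth cutoff functions exhausting a bounded open set. -/
theorem exists_cutoff_seq (hω : IsOpen ω) (hωb : Bornology.IsBounded ω) :
    ∃ χ : ℕ → Eu N → ℝ, (∀ k, IsTestFunction ω (χ k)) ∧ (∀ k x, |χ k x| ≤ 1) ∧
      ∀ x ∈ ω, Tendsto (fun k => χ k x) atTop (𝓝 1) := by
  obtain ⟨f, hfs, hf, hf01⟩ := hω.exists_contDiff_support_eq (n := (⊤ : ℕ∞))
  have hf0 : ∀ x, 0 ≤ f x := fun x => (hf01 ⟨x, rfl⟩).1
  -- The function `f` is positive exactly on `ω`, so this cutoff vanishes where `k f ≤ 1` and equals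
  -- 1 where `k f ≥ 2`. Its support lies in the closed set `{1 ≤ k f} ⊆ ω`.
  refine ⟨fun k x => Real.smoothTransition (k * f x - 1), fun k => ?_, fun k x => ?_, fun x hx => ?_⟩
  · have hsub : tsupport (fun x => Real.smoothTransition (k * f x - 1)) ⊆ {x | 1 ≤ k * f x} := by
      refine closure_minimal (fun x hx => ?_)
        (isClosed_le continuous_const (continuous_const.mul hf.continuous))
      by_contra h
      exact hx (Real.smoothTransition.zero_of_nonpos (by
        simp only [mem_ofPred_eq, not_le] at h; linarith))
    have hsub2 : {x | 1 ≤ k * f x} ⊆ ω := by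
      intro x hx
      rw [← hfs]
      intro h0
      simp only [mem_ofPred_eq, h0, mul_zero] at hx
      linarith
    refine ⟨?_, ?_, hsub.trans hsub2⟩
    · exact Real.smoothTransition.contDiff.comp ((contDiff_const.mul hf).sub contDiff_const)
    · exact Metric.isCompact_of_isClosed_isBounded (isClosed_tsupport _)
        (hωb.subset (hsub.trans hsub2))
  · rw [abs_of_nonneg (Real.smoothTransition.nonneg _)]
    exact Real.smoothTransition.le_one _
  · have hfx : 0 < f x := lt_of_le_of_ne (hf0 x) fun h => by
      rw [← hfs] at hx
      exact hx h.symm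
    refine tendsto_const_nhds.congr' ?_
    obtain ⟨k₀, hk₀⟩ := exists_nat_ge (2 / f x)
    filter_upwards [eventually_ge_atTop k₀] with k hk
    refine (Real.smoothTransition.one_of_one_le ?_).symm
    have : 2 / f x ≤ k := hk₀.trans (by exact_mod_cast hk)
    rw [div_le_iff₀ hfx] at this
    linarith

/-- Density of `C_c^∞(ω)` in `L^p(ω)`. -/
theorem exists_testFunction_seq_tendsto {p : ℝ} (hp : 1 ≤ p) (hω : IsOpen ω)
    (hωb : Bornology.IsBounded ω) {f : Eu N → ℝ}
    (hf : MemLp f (ENNReal.ofReal p) (volume.restrict ω)) :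
    ∃ ψ : ℕ → Eu N → ℝ, (∀ k, IsTestFunction ω (ψ k)) ∧
      Tendsto (fun k => eLpNorm (fun x => f x - ψ k x) (ENNReal.ofReal p) (volume.restrict ω))
        atTop (𝓝 0) := by
  have hp0 : 0 < p := by linarith
  have hp1 : 1 ≤ ENNReal.ofReal p := by simpa using ENNReal.ofReal_le_ofReal hp
  obtain ⟨χ, hχ, hχ1, hχlim⟩ := exists_cutoff_seq hω hωb
  have approx (ε : ℝ) (hε : 0 < ε) : ∃ ψ, IsTestFunction ω ψ ∧
      eLpNorm (fun x => f x - ψ x) (ENNReal.ofReal p) (volume.restrict ω) ≤ ENNReal.ofReal ε := by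
    -- The support of the smooth approximation `g` may leave `ω`; multiplying by the cutoffs repairs
    -- this, with an error that vanishes by dominated convergence.
    obtain ⟨g, hgc, hg, hfg⟩ := hf.exist_eLpNorm_sub_le (by simp) hp1 (half_pos hε)
    have hgp : MemLp g (ENNReal.ofReal p) (volume.restrict ω) :=
      hg.continuous.memLp_of_hasCompactSupport hgc
    have hψ (k : ℕ) : IsTestFunction ω fun x => g x * χ k x :=
      ⟨hg.mul (hχ k).1, (hχ k).2.1.mul_left,
        (closure_mono (Function.support_mul_subset_right g (χ k))).trans (hχ k).2.2⟩
    have hlim : Tendsto (fun k => eLpNorm (fun x => g x - g x * χ k x) (ENNReal.ofReal p)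
        (volume.restrict ω)) atTop (𝓝 0) := by
      simp only [eLpNorm_eq_lintegral_rpow_enorm_toReal (p := ENNReal.ofReal p)
        (by simpa using hp0) (by simp), ENNReal.toReal_ofReal hp0.le]
      have h0 : Tendsto (fun k => ∫⁻ x in ω, ‖g x - g x * χ k x‖ₑ ^ p) atTop
          (𝓝 (∫⁻ x in ω, 0)) := by
        refine tendsto_lintegral_of_dominated_convergence (fun x => (‖(2 : ℝ) * g x‖ₑ) ^ p) ?_ ?_ ?_ ?_
        · intro k
          exact ((hg.continuous.sub (hψ k).continuous).enorm.measurable).pow_const p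
        · intro k
          refine Eventually.of_forall fun x => ENNReal.rpow_le_rpow ?_ hp0.le
          rw [enorm_le_iff_norm_le]
          have h1 := abs_le.1 (hχ1 k x)
          rw [show g x - g x * χ k x = (1 - χ k x) * g x by ring, norm_mul, norm_mul]
          refine mul_le_mul_of_nonneg_right ?_ (norm_nonneg _)
          rw [Real.norm_eq_abs, Real.norm_two]
          exact abs_le.2 ⟨by linarith, by linarith⟩
        · have h := (hgp.const_mul 2).eLpNorm_lt_top
          rw [eLpNorm_lt_top_iff_lintegral_rpow_enorm_lt_top (by simpa using hp0) (by simp),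
            ENNReal.toReal_ofReal hp0.le] at h
          exact h.ne
        · filter_upwards [ae_restrict_mem hω.measurableSet] with x hx
          have h1 : Tendsto (fun k => g x - g x * χ k x) atTop (𝓝 0) := by
            have := ((hχlim x hx).const_mul (g x)).const_sub (g x)
            simpa using this
          have h2 := ((ENNReal.continuous_rpow_const (y := p)).tendsto _).comp h1.enorm
          simpa [ENNReal.zero_rpow_of_pos hp0, Function.comp_def] using h2
      have h1 := ((ENNReal.continuous_rpow_const (y := 1 / p)).tendsto _).comp h0
      simpa [ENNReal.zero_rpow_of_pos (inv_pos.2 hp0), Function.comp_def] using h1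
    obtain ⟨k, hk⟩ := ((ENNReal.tendsto_nhds_zero.1 hlim) (ENNReal.ofReal (ε / 2))
      (by simpa using hε)).exists
    refine ⟨_, hψ k, ?_⟩
    calc eLpNorm (fun x => f x - g x * χ k x) (ENNReal.ofReal p) (volume.restrict ω)
        = eLpNorm ((f - g) + fun x => g x - g x * χ k x) (ENNReal.ofReal p) (volume.restrict ω) := by
          congr 1; ext x; simp
      _ ≤ ENNReal.ofReal (ε / 2) + ENNReal.ofReal (ε / 2) :=
          (eLpNorm_add_le (hf.1.sub hgp.1)
            (hgp.1.sub (hψ k).continuous.aestronglyMeasurable) hp1).trans (add_le_add hfg hk)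
      _ = ENNReal.ofReal ε := by
          rw [← ENNReal.ofReal_add (by positivity) (by positivity), add_halves]
  choose ψ hψ hle using fun k : ℕ => approx (1 / ((k : ℝ) + 1)) Nat.one_div_pos_of_nat
  refine ⟨ψ, hψ, tendsto_of_tendsto_of_tendsto_of_le_of_le tendsto_const_nhds ?_
    (fun _ => zero_le) hle⟩
  have := ENNReal.tendsto_ofReal (tendsto_one_div_add_atTop_nhds_zero_nat (𝕜 := ℝ))
  simpa using this

end Density

/-! ### Competitors affine in `x₁`. -/

section Extension

variable {d : ℕ} {ω : Set (Eu d)}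

/-- For test functions `φ, ψ` on `ω`, the function `φ(X₂) + x₁ ψ(X₂)` agrees near `|x₁| < 1` with a
test function on `ℝ × ω`. -/
theorem exists_testFunction_strip {φ ψ : Eu d → ℝ} (hφ : IsTestFunction ω φ)
    (hψ : IsTestFunction ω ψ) :
    ∃ Φ : Eu (d + 1) → ℝ, IsTestFunction (strip ω) Φ ∧
      ∀ s ∈ Ioo (-1 : ℝ) 1, ∀ y, Φ (pair s y) = φ y + s * ψ y ∧
        ∇ Φ (pair s y) = pair (ψ y) (∇ φ y + s • ∇ ψ y) := by
  -- The bump is 1 on `[-1, 1]`. It only makes the support compact and is invisible in cylinders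
  -- with `ℓ ≤ 1`.
  let χ : ContDiffBump (0 : ℝ) := ⟨1, 2, one_pos, one_lt_two⟩
  let x0 : Eu (d + 1) →L[ℝ] ℝ := EuclideanSpace.proj 0
  have hx0 (x : Eu (d + 1)) : x0 x = x 0 := rfl
  set Ψ : Eu (d + 1) → ℝ := fun x => φ (X2 x) + x 0 * ψ (X2 x) with hΨ
  set Φ : Eu (d + 1) → ℝ := fun x => χ (x 0) * Ψ x with hΦ
  have heq (x : Eu (d + 1)) (hx : x 0 ∈ Ioo (-1 : ℝ) 1) : Φ =ᶠ[𝓝 x] Ψ := by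
    have : ∀ᶠ z : Eu (d + 1) in 𝓝 x, z 0 ∈ Ioo (-1 : ℝ) 1 :=
      x0.continuous.continuousAt.eventually_mem (isOpen_Ioo.mem_nhds hx)
    filter_upwards [this] with z hz
    have : χ (z 0) = 1 := χ.one_of_mem_closedBall (by
      rw [mem_closedBall_zero_iff, Real.norm_eq_abs]
      exact (abs_lt.2 hz).le)
    simp only [hΦ, this, one_mul]
  have hgrad (x : Eu (d + 1)) : ∇ Ψ x = pair (ψ (X2 x)) (∇ φ (X2 x) + x 0 • ∇ ψ (X2 x)) := by
    refine HasGradientAt.gradient ?_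
    rw [hasGradientAt_iff_hasFDerivAt]
    have h1 : HasFDerivAt (fun x => φ (X2 x)) ((fderiv ℝ φ (X2 x)).comp X2L) x :=
      (hφ.differentiable (X2 x)).hasFDerivAt.comp x X2L.hasFDerivAt
    have h2 : HasFDerivAt (fun x => ψ (X2 x)) ((fderiv ℝ ψ (X2 x)).comp X2L) x :=
      (hψ.differentiable (X2 x)).hasFDerivAt.comp x X2L.hasFDerivAt
    have h3 : HasFDerivAt (fun x : Eu (d + 1) => x 0) x0 x := x0.hasFDerivAt
    refine (h1.add (h3.mul h2)).congr_fderiv ?_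
    ext v
    have e := inner_pair (ψ (X2 x)) (∇ φ (X2 x) + x 0 • ∇ ψ (X2 x)) v
    rw [inner_add_left, inner_smul_left, inner_gradient_left, inner_gradient_left] at e
    simp only [InnerProductSpace.toDual_apply_apply, e]
    simp [X2L_apply, hx0]
    ring
  refine ⟨Φ, ⟨?_, ?_⟩, ?_⟩
  · have c1 : ContDiff ℝ (⊤ : ℕ∞) fun x : Eu (d + 1) => x 0 := x0.contDiff
    exact (χ.contDiff.comp c1).mul
      ((hφ.1.comp X2L.contDiff).add (c1.mul (hψ.1.comp X2L.contDiff)))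
  · have hK : IsCompact (pairL '' (tsupport χ ×ˢ (tsupport φ ∪ tsupport ψ))) :=
      (χ.hasCompactSupport.isCompact.prod (hφ.2.1.isCompact.union hψ.2.1.isCompact)).image
        pairL.continuous
    have hsub : tsupport Φ ⊆ pairL '' (tsupport χ ×ˢ (tsupport φ ∪ tsupport ψ)) := by
      refine closure_minimal (fun x hx => ⟨(x 0, X2 x), ⟨subset_tsupport _ ?_, ?_⟩, pair_X2 x⟩)
        hK.isClosed
      · exact fun h => hx (by simp [hΦ, h])
      · by_contra h
        rw [mem_union, not_or] at h
        refine hx ?_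
        simp only [hΦ, hΨ, image_eq_zero_of_notMem_tsupport h.1,
          image_eq_zero_of_notMem_tsupport h.2, mul_zero, add_zero]
    refine ⟨hK.of_isClosed_subset (isClosed_tsupport _) hsub, hsub.trans ?_⟩
    rintro _ ⟨z, hz, rfl⟩
    change X2 (pair z.1 z.2) ∈ ω
    rw [X2_pair]
    exact hz.2.elim (fun h => hφ.2.2 h) fun h => hψ.2.2 h
  · intro s hs y
    have h := heq (pair s y) (by simpa using hs)
    refine ⟨?_, ?_⟩
    · rw [h.eq_of_nhds]; simp [hΨ]
    · rw [h.gradient_eq, hgrad]; simp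

end Extension

/-! ### The upper bound for small `ℓ`. -/

section UpperBound

variable {d : ℕ} {M c p : ℝ} {ω : Set (Eu d)} {A : Eu d → Matrix (Fin (d + 1)) (Fin (d + 1)) ℝ}

/-- The continuous linear map `(a, g) ↦ (a, g)` from `L^q(ℝ) × L^q(ℝ^{n-1})` to `L^q(ℝ^n)`. -/
def pairLp {α : Type*} [MeasurableSpace α] (μ : Measure α) (q : ENNReal) [Fact (1 ≤ q)] :
    Lp ℝ q μ × Lp (Eu d) q μ →L[ℝ] Lp (Eu (d + 1)) q μ :=
  ((pairL.comp (ContinuousLinearMap.inl ℝ ℝ (Eu d))).compLpL q μ).coprod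
    ((pairL.comp (ContinuousLinearMap.inr ℝ ℝ (Eu d))).compLpL q μ)

theorem coeFn_pairLp {α : Type*} [MeasurableSpace α] {μ : Measure α} {q : ENNReal} [Fact (1 ≤ q)]
    (z : Lp ℝ q μ × Lp (Eu d) q μ) : pairLp μ q z =ᵐ[μ] fun y => pair (z.1 y) (z.2 y) := by
  filter_upwards [(pairL.comp (ContinuousLinearMap.inl ℝ ℝ (Eu d))).coeFn_compLpL z.1,
    (pairL.comp (ContinuousLinearMap.inr ℝ ℝ (Eu d))).coeFn_compLpL z.2,
    Lp.coeFn_add ((pairL.comp (ContinuousLinearMap.inl ℝ ℝ (Eu d))).compLpL q μ z.1)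
      ((pairL.comp (ContinuousLinearMap.inr ℝ ℝ (Eu d))).compLpL q μ z.2)] with y h1 h2 h3
  refine h3.trans ?_
  rw [Pi.add_apply, h1, h2, ContinuousLinearMap.comp_apply, ContinuousLinearMap.comp_apply, ← map_add]
  simp [pairL_apply]

theorem exists_energy_lift_lt (hp : 0 < p) (hω : IsOpen ω) (hωne : ω.Nonempty)
    (hA : IsEllipticField (volume.restrict ω) M c A) {T : ℝ} (hT : limitValue p ω A < T) :
    ∃ (u : Eu d → ℝ) (g : Eu d → Eu d), MemW1pZero p ω u g ∧ ∫ y in ω, |u y| ^ p = 1 ∧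
      energy (volume.restrict ω) A p (fun y => lift (A y) (g y)) < T := by
  rw [limitValue_eq hA] at hT
  -- Without a competitor the infimum would be the default value 0 and would yield no
  -- near-minimizer.
  have hne : {E : ℝ | ∃ (u : Eu d → ℝ) (g : Eu d → Eu d), MemW1pZero p ω u g ∧
      ∫ y in ω, |u y| ^ p = 1 ∧
      E = energy (volume.restrict ω) A p (fun y => lift (A y) (g y))}.Nonempty := by
    obtain ⟨y, hy⟩ := hωne
    obtain ⟨φ, hφ, hφ1⟩ := IsTestFunction.exists_pos hω hy
    have hm := hφ.integral_abs_rpow_pos hp hω hy (by simp [hφ1])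
    set m := ∫ y in ω, |φ y| ^ p with hm'
    refine ⟨_, _, _, (hφ.smul (m ^ (-p⁻¹))).memW1pClosure p ω, ?_, rfl⟩
    have ht0 : 0 < m ^ (-p⁻¹) := Real.rpow_pos_of_pos hm _
    simp only [Pi.smul_apply, smul_eq_mul, abs_mul, abs_of_pos ht0]
    simp only [Real.mul_rpow ht0.le (abs_nonneg _)]
    rw [integral_const_mul, ← hm', ← Real.rpow_mul hm.le, neg_mul, inv_mul_cancel₀ hp.ne',
      Real.rpow_neg_one, inv_mul_cancel₀ hm.ne']
  obtain ⟨_, ⟨u, g, h1, h2, rfl⟩, hE⟩ := exists_lt_of_csInf_lt hne hT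
  exact ⟨u, g, h1, h2, hE⟩

/-- The optimal first component `-A₁₂·∇u/a₁₁` is merely in `L^p`, so `x₁` times it need not have a
weak gradient in `L^p`. Replacing it and `u` by test functions costs little, and the strict
inequality leaves a gap that survives for all small `s`. -/
theorem exists_testFunction_energy_lt [Fact (1 ≤ ENNReal.ofReal p)] (hp : 1 ≤ p) (hω : IsOpen ω)
    (hωb : Bornology.IsBounded ω) (hωne : ω.Nonempty)
    (hA : IsEllipticField (volume.restrict ω) M c A) {T : ℝ} (hT : limitValue p ω A < T) :
    ∃ (φ ψ : Eu d → ℝ), IsTestFunction ω φ ∧ IsTestFunction ω ψ ∧ ∃ κ > 0, ∃ δ > 0, ∀ s, |s| < δ →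
      energy (volume.restrict ω) A p (fun y => pair (ψ y) (∇ φ y + s • ∇ ψ y)) + κ ≤
        T * ∫ y in ω, |φ y + s * ψ y| ^ p := by
  have hp0 : 0 < p := by linarith
  set P := ENNReal.ofReal p with hP
  obtain ⟨u, g, hug, hu1, hE⟩ := exists_energy_lift_lt hp0 hω hωne hA hT
  obtain ⟨φ, hφ, hφu, hφg⟩ := hug.2
  have hb := hA.memLp_inner_A12_div hug.1.2.1
  obtain ⟨ψ, hψ, hψb⟩ := exists_testFunction_seq_tendsto hp hω hωb hb
  -- The functional `H(a, u, g)` is the energy of `(a, g)` minus `T` times the mass of `u`. It is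
  -- continuous and negative at the near-minimizer, hence also at some pair of test functions.
  let H : Lp ℝ P (volume.restrict ω) × Lp ℝ P (volume.restrict ω) × Lp (Eu d) P (volume.restrict ω) → ℝ :=
    fun z => energy (volume.restrict ω) A p (pairLp _ P (z.1, z.2.2)) - T * ‖z.2.1‖ ^ p
  have hH : Continuous H := by
    refine ((hA.continuous_energy hp).comp ((pairLp (volume.restrict ω) P).continuous.comp
      (continuous_fst.prodMk (continuous_snd.comp continuous_snd)))).sub
      (continuous_const.mul ?_)
    exact (continuous_fst.comp continuous_snd).norm.rpow_const fun _ => Or.inr hp0.le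
  have hlim : H (hb.toLp _, hug.1.1.toLp u, hug.1.2.1.toLp g) < 0 := by
    have e1 : energy (volume.restrict ω) A p (pairLp _ P (hb.toLp _, hug.1.2.1.toLp g)) =
        energy (volume.restrict ω) A p fun y => lift (A y) (g y) := by
      refine energy_congr ((coeFn_pairLp _).trans ?_)
      filter_upwards [hb.coeFn_toLp, hug.1.2.1.coeFn_toLp] with y h1 h2
      rw [h1, h2, lift]
    have e2 : ‖hug.1.1.toLp u‖ ^ p = 1 := by
      rw [← integral_abs_rpow_eq_norm hp0, ← hu1]
      refine integral_congr_ae ?_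
      filter_upwards [hug.1.1.coeFn_toLp] with y h1
      rw [h1, Real.norm_eq_abs]
    simp only [H, e1, e2]
    linarith
  have t1 := (Lp.tendsto_Lp_iff_tendsto_eLpNorm'' (fun k => ψ k) (fun k => (hψ k).memLp P ω) _ hb).2
    (hψb.congr fun k => eLpNorm_sub_comm _ (ψ k) _ _)
  have t2 := (Lp.tendsto_Lp_iff_tendsto_eLpNorm'' (fun k => φ k) (fun k => (hφ k).memLp P ω) u
    hug.1.1).2 (hφu.congr fun k => eLpNorm_sub_comm u (φ k) _ _)
  have t3 := (Lp.tendsto_Lp_iff_tendsto_eLpNorm'' (fun k => ∇ (φ k))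
    (fun k => (hφ k).memLp_gradient P ω) g hug.1.2.1).2
    (hφg.congr fun k => eLpNorm_sub_comm g (∇ (φ k)) _ _)
  obtain ⟨k, hk⟩ := (((hH.tendsto _).comp (t1.prodMk_nhds (t2.prodMk_nhds t3))).eventually_lt_const
    hlim).exists
  refine ⟨φ k, ψ k, hφ k, hψ k, ?_⟩
  set a := ((hψ k).memLp P ω).toLp (ψ k) with ha
  set b := ((hφ k).memLp P ω).toLp (φ k) with hb'
  set q := ((hφ k).memLp_gradient P ω).toLp (∇ (φ k)) with hq
  set r := ((hψ k).memLp_gradient P ω).toLp (∇ (ψ k)) with hr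
  have hk : H (a, b, q) < 0 := hk
  have hHs : Continuous fun s : ℝ => H (a, b + s • a, q + s • r) :=
    hH.comp (by fun_prop)
  have h0 : H (a, b + (0 : ℝ) • a, q + (0 : ℝ) • r) < H (a, b, q) / 2 := by
    rw [zero_smul, zero_smul, add_zero, add_zero]; linarith
  obtain ⟨δ, hδ, hδs⟩ := Metric.eventually_nhds_iff.1
    ((hHs.tendsto 0).eventually_lt_const h0)
  -- Half of the gap at `s = 0` is kept as `κ`; continuity in `s` may consume the other half.
  refine ⟨-(H (a, b, q) / 2), by linarith, δ, hδ, fun s hs => ?_⟩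
  have h1 := hδs (y := s) (by simpa using hs)
  have e1 : energy (volume.restrict ω) A p (pairLp _ P (a, q + s • r)) =
      energy (volume.restrict ω) A p (fun y => pair (ψ k y) (∇ (φ k) y + s • ∇ (ψ k) y)) := by
    refine energy_congr ((coeFn_pairLp _).trans ?_)
    filter_upwards [((hψ k).memLp P ω).coeFn_toLp, ((hφ k).memLp_gradient P ω).coeFn_toLp,
      ((hψ k).memLp_gradient P ω).coeFn_toLp, Lp.coeFn_add q (s • r), Lp.coeFn_smul s r]
      with y h1 h2 h3 h4 h5
    rw [h4, Pi.add_apply, h5, Pi.smul_apply, h1, h2, h3]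
  have e2 : ‖b + s • a‖ ^ p = ∫ y in ω, |φ k y + s * ψ k y| ^ p := by
    rw [← integral_abs_rpow_eq_norm hp0]
    refine integral_congr_ae ?_
    filter_upwards [((hψ k).memLp P ω).coeFn_toLp, ((hφ k).memLp P ω).coeFn_toLp,
      Lp.coeFn_add b (s • a), Lp.coeFn_smul s a] with y h1 h2 h3 h4
    rw [h3, Pi.add_apply, h4, Pi.smul_apply, h1, h2, Real.norm_eq_abs, smul_eq_mul]
  simp only [H, e1, e2] at h1
  linarith

/-- The affine competitor is inserted in the cylinder and the slice inequality is integrated over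
`|s| < ℓ`: the gap integrates to `2ℓκ > 0`. The functions `φ`, `ψ` depend on `T` but not on `ℓ`. -/
theorem exists_forall_le_of_limitValue_lt [Fact (1 ≤ ENNReal.ofReal p)] (hp : 1 ≤ p) (hω : IsOpen ω)
    (hωb : Bornology.IsBounded ω) (hωne : ω.Nonempty)
    (hA : IsEllipticField (volume.restrict ω) M c A) {T : ℝ} (hT : limitValue p ω A < T) :
    ∃ δ > 0, ∀ ℓ, 0 < ℓ → ℓ < δ → ∀ lam : ℝ,
      (∀ w ∈ sobolevClosure p (cylinder ω ℓ) (strip ω), lam * ‖w.1‖ ^ p ≤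
        energy (volume.restrict (cylinder ω ℓ)) (fun x => A (X2 x)) p w.2) → lam ≤ T := by
  have hp0 : 0 < p := by linarith
  obtain ⟨φ, ψ, hφ, hψ, κ, hκ, δ, hδ, hs⟩ := exists_testFunction_energy_lt hp hω hωb hωne hA hT
  obtain ⟨Φ, hΦ, hΦs⟩ := exists_testFunction_strip hφ hψ
  refine ⟨min δ 1, lt_min hδ one_pos, fun ℓ hℓ hℓδ lam hlam => ?_⟩
  have hB := hA.comp_quasiMeasurePreserving (quasiMeasurePreserving_X2 ω ℓ)
  have h1 := hlam _ hΦ.mem_sobolevClosure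
  have i1 : Integrable (fun x => |Φ x| ^ p) (volume.restrict (cylinder ω ℓ)) := by
    have h := (hΦ.memLp (ENNReal.ofReal p) (cylinder ω ℓ)).integrable_norm_rpow (by simpa using hp0)
      (by simp)
    rwa [ENNReal.toReal_ofReal hp0.le] at h
  have i2 := hB.integrable_energy hp0 (hΦ.memLp_gradient (ENNReal.ofReal p) (cylinder ω ℓ))
  have e1 : ‖(hΦ.memLp (ENNReal.ofReal p) (cylinder ω ℓ)).toLp Φ‖ ^ p =
      ∫ s in Ioo (-ℓ) ℓ, ∫ y in ω, |Φ (pair s y)| ^ p := by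
    rw [← setIntegral_cylinder i1, ← integral_abs_rpow_eq_norm hp0]
    refine integral_congr_ae ?_
    filter_upwards [(hΦ.memLp (ENNReal.ofReal p) (cylinder ω ℓ)).coeFn_toLp] with x hx
    rw [hx, Real.norm_eq_abs]
  simp only [energy_congr (hΦ.memLp_gradient (ENNReal.ofReal p) (cylinder ω ℓ)).coeFn_toLp, e1] at h1
  rw [energy, setIntegral_cylinder i2] at h1
  have j1 := integrable_setIntegral_slice i1
  have j2 := integrable_setIntegral_slice i2
  have h2 : ∫ _s in Ioo (-ℓ) ℓ, κ ≤ ∫ s in Ioo (-ℓ) ℓ, (T * (∫ y in ω, |Φ (pair s y)| ^ p) -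
      ∫ y in ω, form (A (X2 (pair s y))) (∇ Φ (pair s y)) (∇ Φ (pair s y)) ^ (p / 2)) := by
    refine setIntegral_mono_on (integrableOn_const (by simp)) ((j1.const_mul T).sub j2)
      measurableSet_Ioo fun s hsℓ => ?_
    have hs1 : s ∈ Ioo (-1 : ℝ) 1 :=
      ⟨by linarith [hsℓ.1, min_le_right δ 1], by linarith [hsℓ.2, min_le_right δ 1]⟩
    have h3 := hs s (abs_lt.2
      ⟨by linarith [hsℓ.1, min_le_left δ 1], by linarith [hsℓ.2, min_le_left δ 1]⟩)
    simp only [X2_pair, (hΦs s hs1 _).1, (hΦs s hs1 _).2]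
    unfold energy at h3
    linarith
  rw [integral_sub (j1.const_mul T) j2, integral_const_mul] at h2
  have h4 : 0 < ∫ _s in Ioo (-ℓ) ℓ, κ := by
    rw [setIntegral_const, smul_eq_mul]
    refine mul_pos ?_ hκ
    rw [Real.volume_real_Ioo_of_le (by linarith)]
    linarith
  have h5 : 0 ≤ ∫ s in Ioo (-ℓ) ℓ, ∫ y in ω, |Φ (pair s y)| ^ p :=
    integral_nonneg fun s => integral_nonneg fun y => by positivity
  -- With mass `I ≥ 0` and energy `E` of the competitor, `lam I ≤ E < T I` is incompatible with `T <
  -- lam`.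
  by_contra! h
  nlinarith

end UpperBound

end MixedEigen

end

/-! ### Conclusion: the two bounds combined. -/

theorem theorem4p1 (d : ℕ) (hd : 1 ≤ d) (p : ℝ) (hp : 2 ≤ p)
    (ω : Set (MixedEigen.Eu d)) (hω_open : IsOpen ω) (hω_bdd : Bornology.IsBounded ω)
    (hω_ne : ω.Nonempty)
    (A : MixedEigen.Eu d → Matrix (Fin (d + 1)) (Fin (d + 1)) ℝ)
    (hA : MixedEigen.IsAdmissible ω A) :
    (∀ ℓ : ℝ, 0 < ℓ → IsLeast {lam : ℝ | MixedEigen.IsMixedEigenvalue p ω A ℓ lam}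
      (MixedEigen.firstMixedEigenvalue p ω A ℓ)) ∧
    Tendsto (fun ℓ : ℝ => MixedEigen.firstMixedEigenvalue p ω A ℓ) (𝓝[>] 0)
      (𝓝 (MixedEigen.limitValue p ω A)) := by
  have hp1 : 1 ≤ p := by linarith
  have : Fact (1 ≤ ENNReal.ofReal p) := ⟨by simpa using ENNReal.ofReal_le_ofReal hp1⟩
  obtain ⟨M, c, hE⟩ := hA.exists_isEllipticField
  have key (ℓ : ℝ) (hℓ : 0 < ℓ) := MixedEigen.exists_isLeast_isMixedEigenvalue hp hω_open hω_bdd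
    hω_ne hA hℓ
  have hfirst {ℓ lam : ℝ} (h : IsLeast {lam : ℝ | MixedEigen.IsMixedEigenvalue p ω A ℓ lam} lam) :
      MixedEigen.firstMixedEigenvalue p ω A ℓ = lam := h.csInf_eq
  refine ⟨fun ℓ hℓ => ?_, tendsto_order.2 ⟨fun a ha => ?_, fun b hb => ?_⟩⟩
  · obtain ⟨lam, h, -⟩ := key ℓ hℓ
    rwa [hfirst h]
  · filter_upwards [self_mem_nhdsWithin] with ℓ hℓ
    obtain ⟨lam, h, -, z, hz, hz1, hzE⟩ := key ℓ hℓ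
    have h1 := MixedEigen.limitValue_mul_le_of_mem_sobolevClosure hp1 hω_bdd hE ℓ hz
    rw [hz1, Real.one_rpow, mul_one, hzE] at h1
    rw [hfirst h]
    exact ha.trans_le h1
  -- The upper bound gives only a weak inequality with `T`, so `T` is taken strictly between `Λ` and
  -- `b`.
  · obtain ⟨T, hT1, hT2⟩ := exists_between hb
    obtain ⟨δ, hδ, hδT⟩ := MixedEigen.exists_forall_le_of_limitValue_lt hp1 hω_open hω_bdd hω_ne hE hT1
    filter_upwards [Ioo_mem_nhdsGT hδ] with ℓ hℓ
    obtain ⟨lam, h, hmin, -⟩ := key ℓ hℓ.1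
    rw [hfirst h]
    exact (hδT ℓ hℓ.1 hℓ.2 lam hmin).trans_lt hT2
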